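/- Let $(\Omega,\mathcal{B},\mathbf{P})$ be a probability space, let $T:\Omega\to\Omega$ be an invertible (bimeasurable) measure-preserving ergodic transformation, and let $\mathcal{Y}\subseteq\mathcal{B}$ be a sub-$\sigma$-field. Put $\mathcal{Y}_{m,n}=\bigvee_{k=m}^n T^{-k}\mathcal{Y}$ for $-\infty\le m\le n<\infty$. For a $\sigma$-field $\mathcal{Z}\subseteq\mathcal{B}$, the system $(\Omega,\mathcal{B},\mathbf{P},T)$ is called a \emph{conditional $K$-automorphism relative to $\mathcal{Z}$} if there is a $\sigma$-field $\mathcal{X}\subseteq\mathcal{B}$ such that (1) $\mathcal{X}\subseteq T^{-1}\mathcal{X}$; (2) $\bigvee_{k=1}^\infty T^{-k}\mathcal{X}=\mathcal{B}$ mod $\mathbf{P}$; (3) $\bigcap_{k=1}^\infty(\mathcal{Z}\vee T^k\mathcal{X})=\mathcal{Z}$ mod $\mathbf{P}$. Let $U$ be a nonempty measurable space and let $\ell:U\times\Omega\to\mathbb{R}$ be a measurable loss function dominated in $L^1$, i.e. $|\ell(u,\omega)|\le\Lambda(\omega)$ for all $u,\omega$, for some $\Lambda\in L^1(\mathbf{P})$.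 For $v:\Omega\to U$ write $\ell_k(v)(\omega)=\ell(v(\omega),T^k\omega)$. A strategy $\mathbf{u}=(u_k)_{k\ge1}$ of maps $u_k:\Omega\to U$ is \emph{admissible} if each $u_k$ is $\mathcal{Y}_{0,k}$-measurable; let $\mathbb{U}_{0,k}$ be the set of $\mathcal{Y}_{0,k}$-measurable maps $\Omega\to U$, and let $L_N(\mathbf{u})=\frac1N\sum_{k=1}^N\ell_k(u_k)$. An admissible strategy $\mathbf{u}^\star$ is \emph{pathwise optimal} if for every admissible strategy $\mathbf{u}$ $$\liminf_{N\to\infty}\{L_N(\mathbf{u})-L_N(\mathbf{u}^\star)\}\ge0\quad\text{a.s.}$$ By a \emph{mean-optimal strategy} we mean here an admissible strategy $\mathbf{\tilde u}$ such that for every $k\ge1$ $$\mathbf{E}[\ell_k(\tilde u_k)\,|\,\mathcal{Y}_{0,k}]\le\operatorname*{ess\,inf}_{v\in\mathbb{U}_{0,k}}\mathbf{E}[\ell_k(v)\,|\,\mathcal{Y}_{0,k}]+k^{-1}\quad\text{a.s.}$$ \textbf{Theorem.} Suppose that $(\Omega,\mathcal{B},\mathbf{P},T)$ is a conditional $K$-automorphism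 relative to $\mathcal{Y}_{-\infty,0}$, that $U$ is finite, and that $\ell$ is dominated in $L^1$ as above. Then a mean-optimal strategy exists, and every mean-optimal strategy $\mathbf{\tilde u}$ is pathwise optimal. -/

import Mathlib

open MeasureTheory Filter

noncomputable section

namespace PathwiseOptimality

variable {Ω U : Type*}

/-- The σ-field `T ^ (-k) 𝒜 = {T ^ (-k) A : A ∈ 𝒜}`; since `T ^ (-k) A` is the preimage of `A`
under `T ^ k`, this is the comap of `𝒜` under `T ^ k`. -/
abbrev pullback (T : Equiv.Perm Ω) (k : ℤ) (𝒜 : MeasurableSpace Ω) :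
    MeasurableSpace Ω :=
  MeasurableSpace.comap (⇑(T ^ k)) 𝒜

/-- The σ-field `⋁_{k ∈ I} T ^ (-k) 𝒴` generated by the observations at the times in `I ⊆ ℤ`.
`I = Set.Icc m n` gives `𝒴_{m,n}` and `I = Set.Iic n` gives `𝒴_{-∞,n}`. -/
abbrev obs (T : Equiv.Perm Ω) (𝒴 : MeasurableSpace Ω) (I : Set ℤ) : MeasurableSpace Ω :=
  ⨆ k ∈ I, pullback T k 𝒴

/-- Inclusion mod `μ` of σ-fields: every set of `𝒜` is `μ`-a.e. equal to a set of `𝒞`. -/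
def LEMod (𝒜 𝒞 : MeasurableSpace Ω) {ℬ : MeasurableSpace Ω} (μ : Measure Ω) : Prop :=
  ∀ A : Set Ω, MeasurableSet[𝒜] A → ∃ C : Set Ω, MeasurableSet[𝒞] C ∧ A =ᵐ[μ] C

/-- Equality mod `μ` of σ-fields. -/
def EqMod (𝒜 𝒞 : MeasurableSpace Ω) {ℬ : MeasurableSpace Ω} (μ : Measure Ω) : Prop :=
  LEMod 𝒜 𝒞 μ ∧ LEMod 𝒞 𝒜 μ

/-- `(Ω, ℬ, μ, T)` is a conditional `K`-automorphism relative to the sub-σ-field `𝒵`. -/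
def IsCondKAutomorphism (𝒵 : MeasurableSpace Ω) {ℬ : MeasurableSpace Ω} (μ : Measure Ω)
    (T : Equiv.Perm Ω) : Prop :=
  𝒵 ≤ ℬ ∧ ∃ 𝒳 : MeasurableSpace Ω, 𝒳 ≤ ℬ ∧
    𝒳 ≤ pullback T 1 𝒳 ∧
    EqMod (⨆ k : ℤ, ⨆ _ : 1 ≤ k, pullback T k 𝒳) ℬ μ ∧
    EqMod (⨅ k : ℤ, ⨅ _ : 1 ≤ k, 𝒵 ⊔ pullback T (-k) 𝒳) 𝒵 μ

/-- The decisions that can be made on the basis of the information `𝒜`. -/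
def Decisions (U : Type*) [MeasurableSpace U] (𝒜 : MeasurableSpace Ω) : Set (Ω → U) :=
  {u | Measurable[𝒜] u}

/-- A strategy `(u k)_{k ≥ 1}` (the value at `k = 0` is ignored) is admissible if `u k` is
`𝒴_{0,k}`-measurable for every `k ≥ 1`. -/
def IsAdmissible [MeasurableSpace U] (𝒴 : MeasurableSpace Ω) (T : Equiv.Perm Ω)
    (u : ℕ → Ω → U) : Prop :=
  ∀ k : ℕ, 1 ≤ k → u k ∈ Decisions U (obs T 𝒴 (Set.Icc 0 (k : ℤ)))

/-- The loss `ℓ_k(v)(ω) = ℓ(v(ω), T ^ k ω)` of the decision `v` at time `k`. -/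
def lossAt (T : Equiv.Perm Ω) (ℓ : U → Ω → ℝ) (k : ℕ) (v : Ω → U) (ω : Ω) : ℝ :=
  ℓ (v ω) ((T ^ k) ω)

/-- The time-average loss `L_n(u) = n⁻¹ ∑_{k=1}^n ℓ_k(u_k)`. -/
def avgLoss (T : Equiv.Perm Ω) (ℓ : U → Ω → ℝ) (u : ℕ → Ω → U) (n : ℕ) (ω : Ω) : ℝ :=
  (n : ℝ)⁻¹ * ∑ k ∈ Finset.Icc 1 n, lossAt T ℓ k (u k) ω

/-- The loss is dominated in `L¹`. -/
def IsDominated [MeasurableSpace Ω] (μ : Measure Ω) (ℓ : U → Ω → ℝ) : Prop :=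
  ∃ Λ : Ω → ℝ, Integrable Λ μ ∧ ∀ u ω, |ℓ u ω| ≤ Λ ω

/-- `g` is (a version of) the essential infimum of the family `(F i)_i` of random variables. -/
def IsEssInf [MeasurableSpace Ω] (μ : Measure Ω) {ι : Type*} (F : ι → Ω → ℝ) (g : Ω → ℝ) :
    Prop :=
  AEMeasurable g μ ∧ (∀ i, g ≤ᵐ[μ] F i) ∧
    ∀ h : Ω → ℝ, AEMeasurable h μ → (∀ i, h ≤ᵐ[μ] F i) → h ≤ᵐ[μ] g

/-- `u` is a mean-optimal strategy in the sense of conditional near-minimization: it is admissible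
and, for every `k ≥ 1`, almost surely
`E[ℓ_k(u_k) | 𝒴_{0,k}] ≤ essinf_{v ∈ 𝕌_{0,k}} E[ℓ_k(v) | 𝒴_{0,k}] + 1 / k`. -/
def IsMeanOptimal [MeasurableSpace U] (𝒴 : MeasurableSpace Ω) {ℬ : MeasurableSpace Ω}
    (μ : Measure Ω) (T : Equiv.Perm Ω) (ℓ : U → Ω → ℝ) (u : ℕ → Ω → U) : Prop :=
  IsAdmissible 𝒴 T u ∧ ∀ k : ℕ, 1 ≤ k → ∃ g : Ω → ℝ,
    IsEssInf μ (fun v : Decisions U (obs T 𝒴 (Set.Icc 0 (k : ℤ))) ↦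
      μ[lossAt T ℓ k v.1 | obs T 𝒴 (Set.Icc 0 (k : ℤ))]) g ∧
    ∀ᵐ ω ∂μ, (μ[lossAt T ℓ k (u k) | obs T 𝒴 (Set.Icc 0 (k : ℤ))]) ω ≤ g ω + (k : ℝ)⁻¹

/-- `uStar` is pathwise optimal; the lower limit is taken in the extended reals. -/
def IsPathwiseOptimal [MeasurableSpace U] (𝒴 : MeasurableSpace Ω) {ℬ : MeasurableSpace Ω}
    (μ : Measure Ω) (T : Equiv.Perm Ω) (ℓ : U → Ω → ℝ) (uStar : ℕ → Ω → U) : Prop :=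
  IsAdmissible 𝒴 T uStar ∧ ∀ u : ℕ → Ω → U, IsAdmissible 𝒴 T u →
    ∀ᵐ ω ∂μ, (0 : EReal) ≤
      liminf (fun n : ℕ ↦ ((avgLoss T ℓ u n ω - avgLoss T ℓ uStar n ω : ℝ) : EReal)) atTop

end PathwiseOptimality

end

/-! Write `Z` for the infinite observation past `𝒴_{-∞,0}`. Losses are first replaced by their
conditional expectations given `Z`, seen from the current time, and decisions are then compared
through those.

The replacement is `cesaroNull_indicator_sub_condExp`: for integrable `f` and events `A k` in
`𝒴_{-∞,k}`, the time averages of `1_{A k} (f - E[f | Z]) ∘ T^k` tend to zero. Taking for `A k` the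
event that the decision at time `k` is the action `a`, with `f = ℓ a`, and summing over the finitely
many actions covers any admissible strategy. By truncation and condition (2) of the `K` property,
`f` may be taken bounded and `T^{-m}𝒳`-measurable. By condition (3) and Lévy's downward theorem,
`E[f | Z]` is close in `L¹` to `E[f | Z ∨ T^n 𝒳]` for large `n`. The remaining terms `1_{A k} (f -
E[f | Z ∨ T^n 𝒳]) ∘ T^k` are bounded and mutually orthogonal once their times differ by at least `m
+ n`, because the weight `1_{A k}` is measurable for the field being conditioned on. Such variables
obey the strong law (`cesaroNull_of_orthogonal`). The `L¹` errors are harmless almost surely by the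
maximal ergodic theorem (`cesaroNull_of_approx`).

Mean-optimality controls expectations given `𝒴_{0,k}`, which seen from time `k` is `𝒴_{-k,0}`. These
fields increase to `Z`, so by martingale convergence an action that is strictly worse given `Z`
eventually looks worse, by more than `1/k`, given `𝒴_{-k,0}`. Maker's theorem turns this pointwise
fact into negligible average regret along the orbit (`cesaroNull_regret`). -/

noncomputable section

namespace PathwiseOptimality

open Topology

/-! ### Sequences with vanishing time averages. -/

section Cesaro

variable {Ω : Type*} {ℬ : MeasurableSpace Ω} {μ : Measure Ω}

/-- Almost surely, the time averages of `X` over the times `1, …, n` tend to zero. -/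
def CesaroNull {ℬ : MeasurableSpace Ω} (μ : Measure Ω) (X : ℕ → Ω → ℝ) : Prop :=
  ∀ᵐ ω ∂μ, Tendsto (fun n : ℕ ↦ (n : ℝ)⁻¹ * ∑ k ∈ Finset.Icc 1 n, X k ω) atTop (𝓝 0)

theorem CesaroNull.add {X Y : ℕ → Ω → ℝ} (hX : CesaroNull μ X) (hY : CesaroNull μ Y) :
    CesaroNull μ (fun k ω ↦ X k ω + Y k ω) := by
  filter_upwards [hX, hY] with ω h1 h2
  simpa [Finset.sum_add_distrib, mul_add] using h1.add h2

theorem CesaroNull.sub {X Y : ℕ → Ω → ℝ} (hX : CesaroNull μ X) (hY : CesaroNull μ Y) :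
    CesaroNull μ (fun k ω ↦ X k ω - Y k ω) := by
  filter_upwards [hX, hY] with ω h1 h2
  simpa [Finset.sum_sub_distrib, mul_sub] using h1.sub h2

theorem CesaroNull.sum {ι : Type*} (s : Finset ι) {X : ι → ℕ → Ω → ℝ}
    (hX : ∀ i ∈ s, CesaroNull μ (X i)) : CesaroNull μ (fun k ω ↦ ∑ i ∈ s, X i k ω) := by
  classical
  induction s using Finset.induction_on with
  | empty => simp [CesaroNull]
  | insert a s ha ih =>
    simp only [Finset.sum_insert ha]
    exact (hX a (by simp)).add (ih fun i hi ↦ hX i (by simp [hi]))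

theorem CesaroNull.congr {X Y : ℕ → Ω → ℝ} (hX : CesaroNull μ X)
    (h : ∀ k, 1 ≤ k → X k =ᵐ[μ] Y k) : CesaroNull μ Y := by
  have h' : ∀ᵐ ω ∂μ, ∀ k, 1 ≤ k → X k ω = Y k ω := by
    rw [ae_all_iff]; intro k
    by_cases hk : 1 ≤ k
    · filter_upwards [h k hk] with ω hω _ using hω
    · simp [hk]
  filter_upwards [hX, h'] with ω h1 h2
  refine h1.congr fun n ↦ ?_
  rw [Finset.sum_congr rfl fun k hk ↦ h2 k (Finset.mem_Icc.1 hk).1]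

/-- Only finitely many nonzero terms. -/
theorem cesaroNull_of_eventually_zero {X : ℕ → Ω → ℝ} (K : ℕ) (h : ∀ k, K ≤ k → X k = 0) :
    CesaroNull μ X := by
  refine Eventually.of_forall fun ω ↦ ?_
  have h1 : Tendsto (fun n : ℕ ↦ (n : ℝ)⁻¹ * ∑ k ∈ Finset.Icc 1 K, X k ω) atTop (𝓝 0) := by
    simpa using (tendsto_inv_atTop_nhds_zero_nat (𝕜 := ℝ)).mul_const _
  refine h1.congr' ?_
  filter_upwards [eventually_ge_atTop K] with n hn
  congr 1
  refine Finset.sum_subset (Finset.Icc_subset_Icc_right hn) fun k _ hk ↦ ?_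
  rw [h k, Pi.zero_apply]
  simp only [Finset.mem_Icc] at *
  omega

/-! ### The maximal ergodic theorem and the maximal inequality. -/

/-- The running maximum of the Birkhoff sums of `f`, in recursive form. -/
def birkhoffMax (T : Ω → Ω) (f : Ω → ℝ) : ℕ → Ω → ℝ
  | 0 => 0
  | n + 1 => fun ω ↦ max 0 (f ω + birkhoffMax T f n (T ω))

theorem birkhoffMax_nonneg (T : Ω → Ω) (f : Ω → ℝ) (n : ℕ) (ω : Ω) :
    0 ≤ birkhoffMax T f n ω := by
  cases n with
  | zero => exact le_rfl
  | succ n => exact le_max_left _ _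

theorem birkhoffMax_mono (T : Ω → Ω) (f : Ω → ℝ) : Monotone (birkhoffMax T f) := by
  refine monotone_nat_of_le_succ fun n ↦ ?_
  induction n with
  | zero => exact fun ω ↦ birkhoffMax_nonneg T f 1 ω
  | succ n ih => exact fun ω ↦ max_le_max le_rfl (add_le_add le_rfl (ih (T ω)))

theorem birkhoffSum_le_birkhoffMax (T : Ω → Ω) (f : Ω → ℝ) (n : ℕ) (ω : Ω) :
    birkhoffSum T f n ω ≤ birkhoffMax T f n ω := by
  induction n generalizing ω with
  | zero => simp [birkhoffMax]
  | succ n ih =>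
    rw [birkhoffSum_succ']
    exact (add_le_add le_rfl (ih (T ω))).trans (le_max_right _ _)

theorem integrable_birkhoffMax {T : Ω → Ω} (hT : MeasurePreserving T μ μ) {f : Ω → ℝ}
    (hf : Integrable f μ) (n : ℕ) : Integrable (birkhoffMax T f n) μ := by
  induction n with
  | zero => exact integrable_zero _ _ _
  | succ n ih => exact (integrable_zero _ _ _).sup (hf.add (hT.integrable_comp_of_integrable ih))

/-- The maximal ergodic theorem. -/
theorem setIntegral_birkhoffMax_pos_nonneg {T : Ω → Ω} (hT : MeasurePreserving T μ μ)
    {f : Ω → ℝ} (hfm : Measurable f) (hf : Integrable f μ) (n : ℕ) :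
    0 ≤ ∫ ω in {ω | 0 < birkhoffMax T f n ω}, f ω ∂μ := by
  have hmeas : ∀ n, Measurable (birkhoffMax T f n) := by
    intro n
    induction n with
    | zero => exact measurable_const
    | succ n ih => exact measurable_const.max (hfm.add (ih.comp hT.measurable))
  set M := birkhoffMax T f n with hM
  have hMi : Integrable M μ := integrable_birkhoffMax hT hf n
  have hMT : Integrable (M ∘ T) μ := hT.integrable_comp_of_integrable hMi
  have hE : MeasurableSet {ω | 0 < M ω} := measurableSet_lt measurable_const (hmeas n)
  -- Where the maximum is positive it equals `f` plus the previous maximum at `T ω`, and that is at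
  -- most `M (T ω)`. Integrating `M - M ∘ T` then gives something nonnegative by invariance of `μ`.
  have h1 : ∫ ω in {ω | 0 < M ω}, M ω - M (T ω) ∂μ ≤ ∫ ω in {ω | 0 < M ω}, f ω ∂μ := by
    refine setIntegral_mono_on (hMi.sub hMT).integrableOn hf.integrableOn hE fun ω hω ↦ ?_
    cases n with
    | zero => exact absurd (show (0 : ℝ) < 0 from hω) (lt_irrefl _)
    | succ n =>
      have h2 : M ω = f ω + birkhoffMax T f n (T ω) := by
        rcases max_choice 0 (f ω + birkhoffMax T f n (T ω)) with h | h
        · exact absurd (show M ω = 0 from h) (ne_of_gt hω)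
        · exact h
      have h3 := birkhoffMax_mono T f (Nat.le_succ n) (T ω)
      simp only [hM] at h2 ⊢
      linarith
  have h2 : ∫ ω in {ω | 0 < M ω}, M ω - M (T ω) ∂μ =
      ∫ ω, M ω ∂μ - ∫ ω in {ω | 0 < M ω}, M (T ω) ∂μ := by
    refine (integral_sub hMi.integrableOn hMT.integrableOn).trans ?_
    congr 1
    refine setIntegral_eq_integral_of_forall_compl_eq_zero fun ω hω ↦ ?_
    exact le_antisymm (not_lt.1 hω) (birkhoffMax_nonneg T f n ω)
  have h3 : ∫ ω in {ω | 0 < M ω}, M (T ω) ∂μ ≤ ∫ ω, M ω ∂μ := by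
    calc _ ≤ ∫ ω, M (T ω) ∂μ :=
          setIntegral_le_integral hMT (Eventually.of_forall fun ω ↦ birkhoffMax_nonneg T f n _)
      _ = ∫ ω, M ω ∂μ := by
          conv_rhs => rw [← hT.map_eq]
          rw [integral_map hT.measurable.aemeasurable (hT.map_eq.symm ▸ hMi.aestronglyMeasurable)]
  linarith

/-- Averages here start at time `1` and Birkhoff sums at time `0`, hence the extra `T`. -/
theorem sum_Icc_iterate (T : Ω → Ω) (h : Ω → ℝ) (n : ℕ) (ω : Ω) :
    ∑ k ∈ Finset.Icc 1 n, h (T^[k] ω) = birkhoffSum T (h ∘ T) n ω := by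
  rw [birkhoffSum, Finset.range_eq_Ico, ← Finset.Ico_add_one_right_eq_Icc, ← zero_add 1,
    ← Finset.sum_Ico_add' _ 0 n 1]
  simp [Function.iterate_succ_apply']

/-- The weak-type maximal inequality for ergodic averages. -/
theorem maximal_inequality [IsProbabilityMeasure μ] {T : Ω → Ω} (hT : MeasurePreserving T μ μ)
    {h : Ω → ℝ} (hm : Measurable h) (hi : Integrable h μ) (h0 : ∀ ω, 0 ≤ h ω) {δ : ℝ}
    (hδ : 0 < δ) :
    μ {ω | ∃ n : ℕ, n * δ < ∑ k ∈ Finset.Icc 1 n, h (T^[k] ω)} ≤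
      ENNReal.ofReal ((∫ ω, h ω ∂μ) / δ) := by
  set f : Ω → ℝ := fun ω ↦ h (T ω) - δ with hf
  have hTi : Integrable (h ∘ T) μ := hT.integrable_comp_of_integrable hi
  have hfi : Integrable f μ := hTi.sub (integrable_const δ)
  have hfm : Measurable f := (hm.comp hT.measurable).sub measurable_const
  have hmono : Monotone fun n ↦ {ω | 0 < birkhoffMax T f n ω} := fun a b hab ω hω ↦
    lt_of_lt_of_le hω (birkhoffMax_mono T f hab ω)
  have hint : ∫ ω, h (T ω) ∂μ = ∫ ω, h ω ∂μ := by
    conv_rhs => rw [← hT.map_eq]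
    rw [integral_map hT.measurable.aemeasurable hm.aestronglyMeasurable]
  have hn : ∀ n, μ {ω | 0 < birkhoffMax T f n ω} ≤ ENNReal.ofReal ((∫ ω, h ω ∂μ) / δ) := by
    intro n
    have h1 := setIntegral_birkhoffMax_pos_nonneg hT hfm hfi n
    have h1' : ∫ ω in {ω | 0 < birkhoffMax T f n ω}, f ω ∂μ =
        ∫ ω in {ω | 0 < birkhoffMax T f n ω}, h (T ω) ∂μ -
          ∫ _ in {ω | 0 < birkhoffMax T f n ω}, δ ∂μ :=
      integral_sub hTi.integrableOn (integrable_const δ).integrableOn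
    rw [h1', setIntegral_const] at h1
    have h2 := setIntegral_le_integral (s := {ω | 0 < birkhoffMax T f n ω}) hTi
      (Eventually.of_forall fun ω ↦ h0 (T ω))
    simp only [Function.comp_apply] at h2
    rw [hint] at h2
    rw [← ofReal_measureReal]
    refine ENNReal.ofReal_le_ofReal ?_
    rw [le_div_iff₀ hδ]
    simp only [smul_eq_mul] at h1
    linarith
  calc _ ≤ μ (⋃ n, {ω | 0 < birkhoffMax T f n ω}) := by
        refine measure_mono ?_
        rintro ω ⟨n, hω⟩
        refine Set.mem_iUnion.2 ⟨n, ?_⟩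
        refine lt_of_lt_of_le ?_ (birkhoffSum_le_birkhoffMax T f n ω)
        rw [sum_Icc_iterate] at hω
        have : birkhoffSum T f n ω = birkhoffSum T (h ∘ T) n ω - n * δ := by
          simp [birkhoffSum, hf, Finset.sum_sub_distrib]
        linarith
    _ = ⨆ n, μ {ω | 0 < birkhoffMax T f n ω} := hmono.measure_iUnion
    _ ≤ _ := iSup_le hn

/-! ### Criteria for vanishing averages: approximation, domination, orthogonality. -/

/-- Sequences that are approximated by Cesàro null sequences up to an error dominated along the
orbit by a function of small integral are Cesàro null. -/
theorem cesaroNull_of_approx [IsProbabilityMeasure μ] {T : Ω → Ω} (hT : MeasurePreserving T μ μ)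
    {X : ℕ → Ω → ℝ}
    (H : ∀ ε : ℝ, 0 < ε → ∃ (X' : ℕ → Ω → ℝ) (h : Ω → ℝ), CesaroNull μ X' ∧
      Integrable h μ ∧ ∫ ω, |h ω| ∂μ ≤ ε ∧
      ∀ k, 1 ≤ k → ∀ᵐ ω ∂μ, |X k ω - X' k ω| ≤ |h (T^[k] ω)|) :
    CesaroNull μ X := by
  have key : ∀ δ : ℝ, 0 < δ → ∀ᵐ ω ∂μ, ∀ᶠ n : ℕ in atTop,
      |(n : ℝ)⁻¹ * ∑ k ∈ Finset.Icc 1 n, X k ω| ≤ 2 * δ := by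
    intro δ hδ
    rw [ae_iff]
    refine nonpos_iff_eq_zero.1 (le_of_forall_pos_le_add fun ε hε ↦ ?_)
    rw [zero_add]
    -- The maximal inequality bounds by `ε' / δ` the probability that some orbit average of `|h|`
    -- exceeds `δ`; `ε'` is chosen to bring this below `ε`.
    obtain ⟨ε', hε', hle⟩ : ∃ ε' : ℝ, 0 < ε' ∧ ENNReal.ofReal (ε' / δ) ≤ ε := by
      obtain ⟨r, hr0, hr⟩ := ENNReal.lt_iff_exists_nnreal_btwn.1 hε
      refine ⟨r * δ, mul_pos (by exact_mod_cast hr0) hδ, ?_⟩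
      rw [mul_div_cancel_right₀ _ hδ.ne', ENNReal.ofReal_coe_nnreal]
      exact hr.le
    obtain ⟨X', h, hX', hi, hε'', hb⟩ := H ε' hε'
    set g : Ω → ℝ := fun ω ↦ |hi.1.mk h ω| with hg
    have hgm : Measurable g := (hi.1.stronglyMeasurable_mk.measurable).abs
    have hgh : g =ᵐ[μ] fun ω ↦ |h ω| := by
      filter_upwards [hi.1.ae_eq_mk] with ω hω
      simp only [hg, ← hω]
    have hgi : Integrable g μ := hi.abs.congr hgh.symm
    have hgk : ∀ k, ∀ᵐ ω ∂μ, g (T^[k] ω) = |h (T^[k] ω)| := fun k ↦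
      (hT.iterate k).quasiMeasurePreserving.ae hgh
    have hb' : ∀ᵐ ω ∂μ, ∀ k, 1 ≤ k → |X k ω - X' k ω| ≤ g (T^[k] ω) := by
      rw [ae_all_iff]; intro k
      by_cases hk : 1 ≤ k
      · filter_upwards [hb k hk, hgk k] with ω h1 h2 _
        rw [h2]; exact h1
      · simp [hk]
    have hmax := maximal_inequality hT hgm hgi (fun ω ↦ abs_nonneg _) hδ
    rw [integral_congr_ae hgh] at hmax
    have hmax' := hmax.trans ((ENNReal.ofReal_le_ofReal (by gcongr)).trans hle)
    refine (measure_mono_ae ?_).trans hmax'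
    filter_upwards [hX', hb'] with ω h1 h2
    intro hω
    by_contra hcon
    refine hω ?_
    replace hcon : ¬ ∃ n : ℕ, n * δ < ∑ k ∈ Finset.Icc 1 n, g (T^[k] ω) := hcon
    simp only [not_exists, not_lt] at hcon
    have h3 := (tendsto_order.1 h1.abs).2 δ (by simpa using hδ)
    filter_upwards [h3, eventually_ge_atTop 1] with n hn hn1
    have hn0 : (0 : ℝ) < n := by exact_mod_cast hn1
    have h4 : |(n : ℝ)⁻¹ * ∑ k ∈ Finset.Icc 1 n, (X k ω - X' k ω)| ≤ δ := by
      rw [abs_mul, abs_of_pos (inv_pos.2 hn0), inv_mul_le_iff₀ hn0]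
      refine (Finset.abs_sum_le_sum_abs _ _).trans (le_trans ?_ (hcon n))
      exact Finset.sum_le_sum fun k hk ↦ h2 k (Finset.mem_Icc.1 hk).1
    have h5 : (n : ℝ)⁻¹ * ∑ k ∈ Finset.Icc 1 n, X k ω =
        (n : ℝ)⁻¹ * ∑ k ∈ Finset.Icc 1 n, (X k ω - X' k ω) +
        (n : ℝ)⁻¹ * ∑ k ∈ Finset.Icc 1 n, X' k ω := by
      rw [← mul_add, ← Finset.sum_add_distrib]; simp
    rw [h5]
    refine (abs_add_le _ _).trans ?_
    linarith
  have key' : ∀ᵐ ω ∂μ, ∀ m : ℕ, ∀ᶠ n : ℕ in atTop,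
      |(n : ℝ)⁻¹ * ∑ k ∈ Finset.Icc 1 n, X k ω| ≤ 2 * (1 / ((m : ℝ) + 1)) :=
    ae_all_iff.2 fun m ↦ key _ (by positivity)
  filter_upwards [key'] with ω hω
  rw [Metric.tendsto_atTop']
  intro ε hε
  obtain ⟨m, hm⟩ := exists_nat_one_div_lt (half_pos hε)
  obtain ⟨N, hN⟩ := eventually_atTop.1 (hω m)
  refine ⟨N, fun n hn ↦ ?_⟩
  rw [Real.dist_eq, sub_zero]
  linarith [hN n hn.le]

/-- Maker's ergodic theorem for sequences tending to zero. -/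
theorem cesaroNull_of_dominated [IsProbabilityMeasure μ] {T : Ω → Ω}
    (hT : MeasurePreserving T μ μ) {φ : ℕ → Ω → ℝ} {g : Ω → ℝ} (hg : Integrable g μ)
    (hφ : ∀ k, AEStronglyMeasurable (φ k) μ)
    (hb : ∀ k, 1 ≤ k → ∀ᵐ ω ∂μ, |φ k ω| ≤ g ω)
    (h0 : ∀ᵐ ω ∂μ, Tendsto (fun k ↦ φ k ω) atTop (𝓝 0)) :
    CesaroNull μ (fun k ω ↦ φ k (T^[k] ω)) := by
  have hb' : ∀ᵐ ω ∂μ, ∀ k, 1 ≤ k → |φ k ω| ≤ g ω := by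
    rw [ae_all_iff]; intro k
    by_cases hk : 1 ≤ k
    · filter_upwards [hb k hk] with ω hω _ using hω
    · simp [hk]
  -- Tail suprema dominate all terms with index above `K` at once, and their integrals tend to zero.
  -- The terms up to `K` are finitely many and do not affect the averages.
  set s : ℕ → Ω → ℝ := fun K ω ↦ ⨆ j : ℕ, |φ (K + 1 + j) ω| with hs
  have hbdd : ∀ᵐ ω ∂μ, ∀ K, BddAbove (Set.range fun j : ℕ ↦ |φ (K + 1 + j) ω|) := by
    filter_upwards [hb'] with ω hω K
    refine ⟨g ω, ?_⟩
    rintro _ ⟨j, rfl⟩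
    exact hω _ (by omega)
  have hsm : ∀ K, AEStronglyMeasurable (s K) μ := fun K ↦
    (AEMeasurable.iSup fun j ↦ (hφ (K + 1 + j)).aemeasurable.abs).aestronglyMeasurable
  have hs0 : ∀ K ω, 0 ≤ s K ω := fun K ω ↦ Real.iSup_nonneg fun j ↦ abs_nonneg _
  have hsb : ∀ K, ∀ᵐ ω ∂μ, ‖s K ω‖ ≤ g ω := by
    intro K
    filter_upwards [hb'] with ω hω
    rw [Real.norm_of_nonneg (hs0 K ω)]
    exact ciSup_le fun j ↦ hω _ (by omega)
  have hst : ∀ᵐ ω ∂μ, Tendsto (fun K ↦ s K ω) atTop (𝓝 0) := by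
    filter_upwards [h0] with ω hω
    rw [Metric.tendsto_atTop'] at hω ⊢
    intro ε hε
    obtain ⟨N, hN⟩ := hω (ε / 2) (half_pos hε)
    refine ⟨N, fun K hK ↦ ?_⟩
    rw [Real.dist_eq, sub_zero, abs_of_nonneg (hs0 K ω)]
    refine lt_of_le_of_lt (ciSup_le fun j ↦ ?_) (half_lt_self hε)
    have := hN (K + 1 + j) (by omega)
    rw [Real.dist_eq, sub_zero] at this
    exact this.le
  have hint : Tendsto (fun K ↦ ∫ ω, s K ω ∂μ) atTop (𝓝 (∫ _, (0 : ℝ) ∂μ)) :=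
    tendsto_integral_of_dominated_convergence g hsm hg hsb hst
  rw [integral_zero] at hint
  refine cesaroNull_of_approx hT fun ε hε ↦ ?_
  obtain ⟨K, hK⟩ := ((tendsto_order.1 hint).2 ε hε).exists
  refine ⟨fun k ω ↦ if k ≤ K then φ k (T^[k] ω) else 0, s K,
    cesaroNull_of_eventually_zero (K + 1) fun k hk ↦ ?_, hg.mono' (hsm K) (hsb K), ?_, ?_⟩
  · funext ω; simp [show ¬ k ≤ K by omega]
  · simp only [abs_of_nonneg (hs0 K _)]; exact hK.le
  · intro k hk
    filter_upwards [(hT.iterate k).quasiMeasurePreserving.ae hbdd] with ω hω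
    by_cases hkK : k ≤ K
    · simp [hkK]
    · simp only [hkK, if_false, sub_zero]
      rw [abs_of_nonneg (hs0 K _)]
      have := le_ciSup (hω K) (k - (K + 1))
      rwa [show K + 1 + (k - (K + 1)) = k by omega] at this

/-- A strong law of large numbers for bounded random variables that are orthogonal as soon as
their indices are at distance at least `r`. -/
theorem cesaroNull_of_orthogonal [IsProbabilityMeasure μ] {ξ : ℕ → Ω → ℝ} {C : ℝ} (r : ℕ)
    (hm : ∀ k, AEStronglyMeasurable (ξ k) μ) (hC : ∀ k, ∀ᵐ ω ∂μ, |ξ k ω| ≤ C)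
    (horth : ∀ j k, 1 ≤ j → j + r ≤ k → ∫ ω, ξ j ω * ξ k ω ∂μ = 0) : CesaroNull μ ξ := by
  have hC' : ∀ᵐ ω ∂μ, ∀ k, |ξ k ω| ≤ C := ae_all_iff.2 hC
  have hC0 : 0 ≤ C := by
    obtain ⟨ω, hω⟩ := (hC 0).exists
    exact (abs_nonneg _).trans hω
  have hi2 : ∀ j k, Integrable (fun ω ↦ ξ j ω * ξ k ω) μ := fun j k ↦
    Integrable.of_bound ((hm j).mul (hm k)) (C * C) (by
      filter_upwards [hC'] with ω hω
      rw [Real.norm_eq_abs, abs_mul]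
      exact mul_le_mul (hω j) (hω k) (abs_nonneg _) hC0)
  have hle : ∀ j k, ∫ ω, ξ j ω * ξ k ω ∂μ ≤ C * C := by
    intro j k
    have : ∫ ω, ξ j ω * ξ k ω ∂μ ≤ ∫ _, C * C ∂μ := by
      refine integral_mono_ae (hi2 j k) (integrable_const _) ?_
      filter_upwards [hC'] with ω hω
      refine (le_abs_self _).trans ?_
      rw [abs_mul]
      exact mul_le_mul (hω j) (hω k) (abs_nonneg _) hC0
    simpa using this
  set S : ℕ → Ω → ℝ := fun n ω ↦ ∑ k ∈ Finset.Icc 1 n, ξ k ω with hS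
  have hSm : ∀ n, AEStronglyMeasurable (S n) μ := fun n ↦
    Finset.aestronglyMeasurable_fun_sum _ fun k _ ↦ hm k
  have hSsq : ∀ n ω, S n ω ^ 2 = ∑ j ∈ Finset.Icc 1 n, ∑ k ∈ Finset.Icc 1 n, ξ j ω * ξ k ω :=
    fun n ω ↦ by rw [sq, hS, Finset.sum_mul_sum]
  have hSi : ∀ n, Integrable (fun ω ↦ S n ω ^ 2) μ := by
    intro n
    simp only [hSsq]
    exact integrable_finsetSum _ fun j _ ↦ integrable_finsetSum _ fun k _ ↦ hi2 j k
  -- For each `j` at most `2r + 1` indices `k` lie within distance `r`; all other products integrate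
  -- to zero.
  have hvar : ∀ n : ℕ, ∫ ω, S n ω ^ 2 ∂μ ≤ n * ((2 * r + 1) * (C * C)) := by
    intro n
    simp only [hSsq]
    rw [integral_finsetSum _ fun j _ ↦ integrable_finsetSum _ fun k _ ↦ hi2 j k]
    have h1 : ∀ j ∈ Finset.Icc 1 n,
        ∫ ω, ∑ k ∈ Finset.Icc 1 n, ξ j ω * ξ k ω ∂μ ≤ (2 * r + 1) * (C * C) := by
      intro j hj
      rw [integral_finsetSum _ fun k _ ↦ hi2 j k]
      have h2 : ∀ k ∈ Finset.Icc 1 n, ∫ ω, ξ j ω * ξ k ω ∂μ ≤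
          if k ∈ Finset.Icc (j - r) (j + r) then C * C else 0 := by
        intro k hk
        simp only [Finset.mem_Icc] at hj hk ⊢
        split_ifs with h
        · exact hle j k
        · by_cases hjk : j + r ≤ k
          · exact (horth j k hj.1 hjk).le
          · simp_rw [mul_comm (ξ j _)]
            exact (horth k j hk.1 (by omega)).le
      refine (Finset.sum_le_sum h2).trans ?_
      rw [← Finset.sum_filter, Finset.sum_const, nsmul_eq_mul]
      refine mul_le_mul_of_nonneg_right ?_ (mul_nonneg hC0 hC0)
      have : (Finset.filter (fun k ↦ k ∈ Finset.Icc (j - r) (j + r)) (Finset.Icc 1 n)).card ≤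
          2 * r + 1 := by
        refine (Finset.card_le_card (t := Finset.Icc (j - r) (j + r)) fun k hk ↦
          (Finset.mem_filter.1 hk).2).trans ?_
        rw [Nat.card_Icc]; omega
      exact_mod_cast this
    refine (Finset.sum_le_sum h1).trans ?_
    simp
  -- Along the squares the variances of the averages are of order `1 / j²`, hence summable, so the
  -- squared averages are almost surely summable.
  have hsum : ∀ᵐ ω ∂μ, Tendsto (fun j : ℕ ↦ ((j : ℝ) ^ 2)⁻¹ * S (j ^ 2) ω) atTop (𝓝 0) := by
    have hfin : ∫⁻ ω, ∑' j : ℕ, ENNReal.ofReal ((((j : ℝ) ^ 2)⁻¹ * S (j ^ 2) ω) ^ 2) ∂μ ≠ ⊤ := by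
      rw [lintegral_tsum fun j ↦
        (((hSm (j ^ 2)).aemeasurable.const_mul _).pow_const 2).ennreal_ofReal]
      have hterm : ∀ j : ℕ, ∫⁻ ω, ENNReal.ofReal ((((j : ℝ) ^ 2)⁻¹ * S (j ^ 2) ω) ^ 2) ∂μ ≤
          ENNReal.ofReal (((2 * r + 1) * (C * C)) * (1 / (j : ℝ) ^ 2)) := by
        intro j
        simp only [mul_pow]
        rw [← ofReal_integral_eq_lintegral_ofReal ((hSi _).const_mul _)
          (Eventually.of_forall fun ω ↦ by positivity), integral_const_mul]
        refine ENNReal.ofReal_le_ofReal ?_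
        rcases Nat.eq_zero_or_pos j with rfl | hj
        · simp
        · have hj' : (0 : ℝ) < j := by exact_mod_cast hj
          have := mul_le_mul_of_nonneg_left (hvar (j ^ 2))
            (by positivity : (0 : ℝ) ≤ ((j : ℝ) ^ 2)⁻¹ ^ 2)
          refine this.trans (le_of_eq ?_)
          push_cast
          field_simp
      refine ne_top_of_le_ne_top ?_ (ENNReal.tsum_le_tsum hterm)
      exact ((Real.summable_one_div_nat_pow.2 one_lt_two).mul_left _).tsum_ofReal_ne_top
    have hae := ae_lt_top' (AEMeasurable.tsum fun j ↦
        (((hSm (j ^ 2)).aemeasurable.const_mul (((j : ℝ) ^ 2)⁻¹)).pow_const 2).ennreal_ofReal) hfin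
    filter_upwards [hae] with ω hω
    have h1 := ENNReal.tendsto_atTop_zero_of_tsum_ne_top hω.ne
    have h2 := (ENNReal.tendsto_toReal ENNReal.zero_ne_top).comp h1
    have h3 : Tendsto (fun j : ℕ ↦ (((j : ℝ) ^ 2)⁻¹ * S (j ^ 2) ω) ^ 2) atTop (𝓝 0) := by
      refine (h2.congr fun j ↦ ?_)
      exact ENNReal.toReal_ofReal (sq_nonneg _)
    have h4 := h3.sqrt
    rw [Real.sqrt_zero] at h4
    simp only [Real.sqrt_sq_eq_abs] at h4
    exact (tendsto_zero_iff_abs_tendsto_zero _).2 h4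
  filter_upwards [hsum, hC'] with ω h1 h2
  have hsq : Tendsto Nat.sqrt atTop atTop :=
    tendsto_atTop_atTop.2 fun b ↦ ⟨b ^ 2, fun n hn ↦ Nat.le_sqrt'.2 hn⟩
  have h3 : Tendsto (fun n : ℕ ↦ |((Nat.sqrt n : ℝ) ^ 2)⁻¹ * S (Nat.sqrt n ^ 2) ω| +
      2 * C * (Nat.sqrt n : ℝ)⁻¹) atTop (𝓝 0) := by
    have h5 := (h1.abs.add ((tendsto_inv_atTop_nhds_zero_nat (𝕜 := ℝ)).const_mul (2 * C))).comp hsq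
    simpa [Function.comp_def] using h5
  refine squeeze_zero_norm' ?_ h3
  filter_upwards [eventually_ge_atTop 1] with n hn
  -- Between consecutive squares at most `2j` terms are added, each bounded by `C`, which changes
  -- the average by at most `2C / j`.
  set j := Nat.sqrt n with hj
  have hj1 : 1 ≤ j := Nat.le_sqrt'.2 (by simpa using hn)
  have hjn : j ^ 2 ≤ n := Nat.sqrt_le' n
  have hnj : n ≤ j ^ 2 + 2 * j := by
    have := Nat.lt_succ_sqrt' n
    simp only [← hj, Nat.succ_eq_add_one] at this
    nlinarith
  have hjR : (0 : ℝ) < j := by exact_mod_cast hj1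
  have hnR : (j : ℝ) ^ 2 ≤ n := by exact_mod_cast hjn
  have hsplit : |S n ω| ≤ |S (j ^ 2) ω| + 2 * j * C := by
    have hun : Finset.Icc 1 n = Finset.Icc 1 (j ^ 2) ∪ Finset.Icc (j ^ 2 + 1) n := by
      ext k; simp only [Finset.mem_union, Finset.mem_Icc]; omega
    have hdis : Disjoint (Finset.Icc 1 (j ^ 2)) (Finset.Icc (j ^ 2 + 1) n) := by
      rw [Finset.disjoint_left]; intro k; simp only [Finset.mem_Icc]; omega
    have : S n ω = S (j ^ 2) ω + ∑ k ∈ Finset.Icc (j ^ 2 + 1) n, ξ k ω := by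
      simp only [hS]; rw [hun, Finset.sum_union hdis]
    rw [this]
    refine (abs_add_le _ _).trans (add_le_add le_rfl ?_)
    refine (Finset.abs_sum_le_sum_abs _ _).trans ?_
    refine (Finset.sum_le_sum fun k _ ↦ h2 k).trans ?_
    rw [Finset.sum_const, nsmul_eq_mul, Nat.card_Icc]
    refine mul_le_mul_of_nonneg_right ?_ hC0
    have : n + 1 - (j ^ 2 + 1) ≤ 2 * j := by omega
    exact_mod_cast this
  have hn0 : (0 : ℝ) < n := by exact_mod_cast hn
  rw [Real.norm_eq_abs, abs_mul, abs_of_pos (inv_pos.2 hn0), abs_mul,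
    abs_of_pos (inv_pos.2 (pow_pos hjR 2))]
  calc (n : ℝ)⁻¹ * |S n ω| ≤ ((j : ℝ) ^ 2)⁻¹ * (|S (j ^ 2) ω| + 2 * j * C) := by
        gcongr
    _ = _ := by field_simp

end Cesaro

/-! ### Conditional expectations: decreasing limits, null modifications, shifts. -/

section ConditionalExpectation

variable {Ω : Type*} {ℬ : MeasurableSpace Ω} {μ : Measure Ω}

/-- A function that is almost surely measurable for every member of a decreasing sequence of
σ-fields is almost surely measurable for the intersection. -/
theorem aestronglyMeasurable_iInf_of_antitone {G : ℕ → MeasurableSpace Ω} (hG : Antitone G)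
    {f : Ω → ℝ} (hf : ∀ n, AEStronglyMeasurable[G n] f μ) :
    AEStronglyMeasurable[⨅ n, G n] f μ := by
  set g : ℕ → Ω → ℝ := fun n ↦ (hf n).mk f with hg
  have hgm : ∀ n, Measurable[G n] (g n) := fun n ↦ (hf n).stronglyMeasurable_mk.measurable
  have hlim : Measurable[⨅ n, G n] (fun ω ↦ limsup (fun n ↦ g n ω) atTop) := by
    intro s hs
    rw [MeasurableSpace.measurableSet_iInf]
    intro m
    -- The limsup ignores the first `m` versions, so it is measurable for every `G m`.
    have h1 : (fun ω ↦ limsup (fun n ↦ g n ω) atTop) =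
        fun ω ↦ limsup (fun n ↦ g (n + m) ω) atTop := by
      funext ω
      exact (limsup_nat_add (fun n ↦ g n ω) m).symm
    rw [h1]
    exact (@Measurable.limsup _ _ _ _ _ (G m) _ _ _ _ fun n ↦
      (hgm (n + m)).mono (hG (Nat.le_add_left m n)) le_rfl) hs
  refine ⟨_, hlim.stronglyMeasurable, ?_⟩
  have hall : ∀ᵐ ω ∂μ, ∀ n, f ω = g n ω := ae_all_iff.2 fun n ↦ (hf n).ae_eq_mk
  filter_upwards [hall] with ω hω
  have : (fun n ↦ g n ω) = fun _ ↦ f ω := funext fun n ↦ (hω n).symm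
  rw [this, limsup_const]

/-- Lévy's downward theorem in `L²`, with the convergence expressed in `L¹`. -/
theorem tendsto_integral_abs_condExp_iInf [IsProbabilityMeasure μ] {G : ℕ → MeasurableSpace Ω}
    (hG : Antitone G) (hGB : ∀ n, G n ≤ ℬ) {f : Ω → ℝ} (hf : MemLp f 2 μ) :
    Tendsto (fun n ↦ ∫ ω, |(μ[f | G n]) ω - (μ[f | ⨅ n, G n]) ω| ∂μ) atTop (𝓝 0) := by
  have hinf : ⨅ n, G n ≤ ℬ := (iInf_le G 0).trans (hGB 0)
  have : ∀ n, Fact (G n ≤ ℬ) := fun n ↦ ⟨hGB n⟩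
  have : Fact (⨅ n, G n ≤ ℬ) := ⟨hinf⟩
  set K : ℕ → Submodule ℝ (Lp ℝ 2 μ) := fun n ↦ lpMeas ℝ ℝ (G n) 2 μ with hK
  set L : Submodule ℝ (Lp ℝ 2 μ) := lpMeas ℝ ℝ (⨅ n, G n) 2 μ with hL
  have hKL : ⨅ n, K n = L := by
    ext x
    simp only [hK, hL, Submodule.mem_iInf, mem_lpMeas_iff_aestronglyMeasurable]
    exact ⟨fun h ↦ aestronglyMeasurable_iInf_of_antitone hG h, fun h n ↦ h.mono (iInf_le G n)⟩
  have hanti : Antitone K := fun m n hmn x hx ↦ by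
    simp only [hK, mem_lpMeas_iff_aestronglyMeasurable] at hx ⊢
    exact hx.mono (hG hmn)
  -- Projections converge along increasing subspaces; passing to orthogonal complements turns the
  -- decreasing family `K n` into an increasing one.
  have hmono : Monotone fun n ↦ (K n)ᗮ := fun m n hmn ↦ Submodule.orthogonal_le (hanti hmn)
  have hcl : (⨆ n, (K n)ᗮ).topologicalClosure = Lᗮ := by
    rw [← Submodule.orthogonal_orthogonal_eq_closure, ← Submodule.iInf_orthogonal, ← hKL]
    congr 1
    exact iInf_congr fun n ↦ Submodule.orthogonal_orthogonal _
  have hlim := Submodule.starProjection_tendsto_closure_iSup (fun n ↦ (K n)ᗮ) hmono hf.toLp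
  simp only [hcl, Submodule.starProjection_orthogonal'] at hlim
  have hlim' : Tendsto (fun n ↦ (K n).starProjection hf.toLp) atTop
      (𝓝 (L.starProjection hf.toLp)) := by
    simpa using (tendsto_const_nhds (x := hf.toLp)).sub hlim
  rw [Lp.tendsto_Lp_iff_tendsto_eLpNorm'] at hlim'
  have hle : ∀ n, ∫ ω, |(μ[f | G n]) ω - (μ[f | ⨅ n, G n]) ω| ∂μ ≤
      (eLpNorm (⇑((K n).starProjection hf.toLp) - ⇑(L.starProjection hf.toLp)) 2 μ).toReal := by
    intro n
    have e1 : (μ[f | G n] - μ[f | ⨅ n, G n] : Ω → ℝ) =ᵐ[μ]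
        (⇑((K n).starProjection hf.toLp) - ⇑(L.starProjection hf.toLp) : Ω → ℝ) :=
      (hf.condExpL2_ae_eq_condExp (𝕜 := ℝ) (hGB n)).symm.sub
        (hf.condExpL2_ae_eq_condExp (𝕜 := ℝ) hinf).symm
    rw [← eLpNorm_congr_ae e1]
    have hi : Integrable (μ[f | G n] - μ[f | ⨅ n, G n]) μ :=
      integrable_condExp.sub integrable_condExp
    have e2 : ∫ ω, |(μ[f | G n]) ω - (μ[f | ⨅ n, G n]) ω| ∂μ =
        (eLpNorm (μ[f | G n] - μ[f | ⨅ n, G n]) 1 μ).toReal := by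
      rw [eLpNorm_one_eq_lintegral_enorm, ← integral_norm_eq_lintegral_enorm hi.1]
      rfl
    rw [e2]
    refine ENNReal.toReal_mono ?_ (eLpNorm_le_eLpNorm_of_exponent_le one_le_two hi.1)
    rw [eLpNorm_congr_ae e1]
    exact ((Lp.memLp _).sub (Lp.memLp _)).2.ne
  have hto := (ENNReal.tendsto_toReal ENNReal.zero_ne_top).comp hlim'
  exact squeeze_zero (fun n ↦ integral_nonneg fun ω ↦ abs_nonneg _) hle hto

/-- If `𝒲` is contained in `𝒵 ⊆ 𝒲` mod `μ`, conditioning on either is the same. -/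
theorem condExp_ae_eq_of_leMod [IsProbabilityMeasure μ] {𝒵 𝒲 : MeasurableSpace Ω} (h1 : 𝒵 ≤ 𝒲)
    (h2 : 𝒲 ≤ ℬ) (h : LEMod 𝒲 𝒵 μ) {f : Ω → ℝ} (hf : Integrable f μ) :
    μ[f | 𝒲] =ᵐ[μ] μ[f | 𝒵] := by
  symm
  refine ae_eq_condExp_of_forall_setIntegral_eq h2 hf (fun s _ _ ↦ integrable_condExp.integrableOn)
    (fun s hs _ ↦ ?_) (stronglyMeasurable_condExp.mono h1).aestronglyMeasurable
  obtain ⟨C, hC, hsC⟩ := h s hs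
  rw [setIntegral_congr_set hsC, setIntegral_congr_set hsC,
    setIntegral_condExp (h1.trans h2) hf hC]

/-- `f` need not be `𝒲`-measurable, so integrals are compared over all measurable sets, each a null
modification of a set of `𝒲`. -/
theorem condExp_self_of_leMod [IsProbabilityMeasure μ] {𝒲 : MeasurableSpace Ω} (h2 : 𝒲 ≤ ℬ)
    (h : LEMod ℬ 𝒲 μ) {f : Ω → ℝ} (hf : Integrable f μ) : μ[f | 𝒲] =ᵐ[μ] f := by
  symm
  refine ae_eq_of_forall_setIntegral_eq_of_sigmaFinite (fun s _ _ ↦ hf.integrableOn)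
    (fun s _ _ ↦ integrable_condExp.integrableOn) (fun s hs _ ↦ ?_)
  obtain ⟨C, hC, hsC⟩ := h s hs
  rw [setIntegral_congr_set hsC, setIntegral_congr_set hsC, setIntegral_condExp h2 hf hC]

/-- Conditional expectations commute with measure-preserving maps. -/
theorem condExp_comp_ae_eq {𝒢 ℬ : MeasurableSpace Ω} {μ : Measure Ω} [IsProbabilityMeasure μ]
    {S : Ω → Ω} (hS : MeasurePreserving S μ μ) (h𝒢 : 𝒢 ≤ ℬ) {f : Ω → ℝ} (hf : Integrable f μ) :
    (fun ω ↦ (μ[f | 𝒢]) (S ω)) =ᵐ[μ] μ[fun ω ↦ f (S ω) | 𝒢.comap S] := by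
  have hle : 𝒢.comap S ≤ ℬ := by
    rintro _ ⟨A, hA, rfl⟩
    exact hS.measurable (h𝒢 A hA)
  have hset : ∀ {g : Ω → ℝ} (_ : Integrable g μ) {A : Set Ω} (_ : MeasurableSet A),
      ∫ ω in S ⁻¹' A, g (S ω) ∂μ = ∫ ω in A, g ω ∂μ := by
    intro g hg A hA
    have := setIntegral_map (μ := μ) (g := S) (f := g) hA
      (hS.map_eq.symm ▸ hg.aestronglyMeasurable) hS.measurable.aemeasurable
    rw [hS.map_eq] at this
    exact this.symm
  refine ae_eq_condExp_of_forall_setIntegral_eq hle (hS.integrable_comp_of_integrable hf)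
    (fun s _ _ ↦ (hS.integrable_comp_of_integrable integrable_condExp).integrableOn) ?_ ?_
  · rintro _ ⟨A, hA, rfl⟩ _
    rw [hset integrable_condExp (h𝒢 A hA), hset hf (h𝒢 A hA), setIntegral_condExp h𝒢 hf hA]
  · have : Measurable[𝒢.comap S] (fun ω ↦ (μ[f | 𝒢]) (S ω)) :=
      (stronglyMeasurable_condExp (m := 𝒢)).measurable.comp (comap_measurable S)
    exact this.stronglyMeasurable.aestronglyMeasurable

end ConditionalExpectation

/-! ### Shifting the observation fields. -/

section SigmaFields

variable {Ω : Type*}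

theorem pullback_pullback (T : Equiv.Perm Ω) (j k : ℤ) (𝒜 : MeasurableSpace Ω) :
    pullback T j (pullback T k 𝒜) = pullback T (k + j) 𝒜 := by
  rw [pullback, pullback, pullback, MeasurableSpace.comap_comp, ← Equiv.Perm.coe_mul, ← zpow_add]

theorem pullback_mono (T : Equiv.Perm Ω) (k : ℤ) {𝒜 𝒞 : MeasurableSpace Ω} (h : 𝒜 ≤ 𝒞) :
    pullback T k 𝒜 ≤ pullback T k 𝒞 :=
  MeasurableSpace.comap_mono h

theorem pullback_sup (T : Equiv.Perm Ω) (k : ℤ) (𝒜 𝒞 : MeasurableSpace Ω) :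
    pullback T k (𝒜 ⊔ 𝒞) = pullback T k 𝒜 ⊔ pullback T k 𝒞 :=
  MeasurableSpace.comap_sup

theorem pullback_le_of_le {𝒜 ℬ : MeasurableSpace Ω} {μ : Measure Ω} {T : Equiv.Perm Ω}
    (hT : ∀ k : ℤ, MeasurePreserving (⇑(T ^ k)) μ μ) (h : 𝒜 ≤ ℬ)
    (k : ℤ) : pullback T k 𝒜 ≤ ℬ :=
  (MeasurableSpace.comap_mono h).trans (hT k).measurable.comap_le

theorem obs_le {ℬ : MeasurableSpace Ω} {μ : Measure Ω} {T : Equiv.Perm Ω}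
    (hT : ∀ k : ℤ, MeasurePreserving (⇑(T ^ k)) μ μ) {𝒴 : MeasurableSpace Ω} (h : 𝒴 ≤ ℬ)
    (I : Set ℤ) : obs T 𝒴 I ≤ ℬ :=
  iSup₂_le fun k _ ↦ pullback_le_of_le hT h k

theorem obs_mono (T : Equiv.Perm Ω) (𝒴 : MeasurableSpace Ω) {I J : Set ℤ} (h : I ⊆ J) :
    obs T 𝒴 I ≤ obs T 𝒴 J :=
  biSup_mono fun _ hk ↦ h hk

theorem pullback_obs (T : Equiv.Perm Ω) (𝒴 : MeasurableSpace Ω) (k : ℤ) (I J : Set ℤ)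
    (h : ∀ i, i ∈ I ↔ i + k ∈ J) : pullback T k (obs T 𝒴 I) = obs T 𝒴 J := by
  have h1 : pullback T k (obs T 𝒴 I) = ⨆ i ∈ I, pullback T (i + k) 𝒴 := by
    rw [pullback, obs, MeasurableSpace.comap_iSup]
    refine iSup_congr fun i ↦ ?_
    rw [MeasurableSpace.comap_iSup]
    exact iSup_congr fun _ ↦ pullback_pullback T k i 𝒴
  rw [h1]
  refine le_antisymm (iSup₂_le fun i hi ↦ ?_) (iSup₂_le fun j hj ↦ ?_)
  · exact le_iSup₂_of_le (i + k) ((h i).1 hi) le_rfl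
  · refine le_iSup₂_of_le (j - k) ((h _).2 (by simpa using hj)) ?_
    rw [sub_add_cancel]

theorem pullback_le_pullback {T : Equiv.Perm Ω} {𝒳 : MeasurableSpace Ω} (h : 𝒳 ≤ pullback T 1 𝒳) :
    Monotone fun k : ℤ ↦ pullback T k 𝒳 := by
  refine monotone_int_of_le_succ fun k ↦ ?_
  have := pullback_mono T k h
  rwa [pullback_pullback, add_comm] at this

theorem zpow_natCast_eq_iterate (T : Equiv.Perm Ω) (k : ℕ) : ⇑(T ^ (k : ℤ)) = (⇑T)^[k] := by
  rw [zpow_natCast, Equiv.Perm.coe_pow]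

end SigmaFields

/-! ### The conditional `K` property and innovations. -/

section Decomposition

variable {Ω : Type*} {𝒴 𝒳 𝒵 𝒢 : MeasurableSpace Ω} {ℬ : MeasurableSpace Ω} {μ : Measure Ω}
  {T : Equiv.Perm Ω}

/-- An indicator is at most `1`, so the error is dominated by `|g - g'|` along the orbit whatever
the events `A k` are. -/
theorem cesaroNull_indicator_of_approx [IsProbabilityMeasure μ] (hT : MeasurePreserving T μ μ) {A : ℕ → Set Ω}
    {g : Ω → ℝ} (hg : Integrable g μ)
    (H : ∀ ε : ℝ, 0 < ε → ∃ g' : Ω → ℝ, Integrable g' μ ∧ ∫ ω, |g ω - g' ω| ∂μ ≤ ε ∧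
      CesaroNull μ fun k ↦ (A k).indicator fun ω ↦ g' (T^[k] ω)) :
    CesaroNull μ fun k ↦ (A k).indicator fun ω ↦ g (T^[k] ω) := by
  refine cesaroNull_of_approx hT fun ε hε ↦ ?_
  obtain ⟨g', hg', hle, hnull⟩ := H ε hε
  refine ⟨_, fun ω ↦ g ω - g' ω, hnull, hg.sub hg', hle, fun k _ ↦ Eventually.of_forall fun ω ↦ ?_⟩
  by_cases hω : ω ∈ A k <;> simp [hω]

theorem integral_mul_eq_zero_of_condExp {ℋ ℬ : MeasurableSpace Ω} {μ : Measure Ω}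
    [IsProbabilityMeasure μ] (hℋ : ℋ ≤ ℬ) {y w : Ω → ℝ}
    (hy : StronglyMeasurable[ℋ] y) (hw : Integrable w μ) (hyw : Integrable (fun ω ↦ y ω * w ω) μ)
    (h0 : μ[w | ℋ] =ᵐ[μ] 0) : ∫ ω, y ω * w ω ∂μ = 0 := by
  rw [← integral_condExp hℋ]
  refine integral_eq_zero_of_ae ?_
  refine (condExp_mul_of_stronglyMeasurable_left hy hyw hw).trans ?_
  filter_upwards [h0] with ω hω
  simp [hω]

theorem condExp_sub_condExp_ae_eq_zero [IsProbabilityMeasure μ] (h𝒢 : 𝒢 ≤ ℬ) {f : Ω → ℝ}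
    (hf : Integrable f μ) : μ[fun ω ↦ f ω - (μ[f | 𝒢]) ω | 𝒢] =ᵐ[μ] 0 := by
  refine (condExp_sub hf integrable_condExp 𝒢).trans ?_
  have : μ[μ[f | 𝒢] | 𝒢] = μ[f | 𝒢] :=
    condExp_of_stronglyMeasurable h𝒢 stronglyMeasurable_condExp integrable_condExp
  rw [this, sub_self]

theorem pullback_past (T : Equiv.Perm Ω) (𝒴 𝒳 : MeasurableSpace Ω) (k : ℕ) (i : ℤ) :
    pullback T k (obs T 𝒴 (Set.Iic 0) ⊔ pullback T i 𝒳) =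
      obs T 𝒴 (Set.Iic (k : ℤ)) ⊔ pullback T (i + k) 𝒳 := by
  rw [pullback_sup, pullback_pullback, pullback_obs T 𝒴 k (Set.Iic 0) (Set.Iic (k : ℤ))]
  simp

theorem measurePreserving_iterate_of_zpow (hT : ∀ k : ℤ, MeasurePreserving (⇑(T ^ k)) μ μ)
    (k : ℕ) : MeasurePreserving (T^[k]) μ μ := by
  rw [← zpow_natCast_eq_iterate]
  exact hT k

/-- Averages of bounded innovations over a window of length `m + n`. -/
theorem cesaroNull_indicator_of_condExp_eq_zero [IsProbabilityMeasure μ]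
    (hT : ∀ k : ℤ, MeasurePreserving (⇑(T ^ k)) μ μ)
    (h𝒴 : 𝒴 ≤ ℬ) (h𝒳 : 𝒳 ≤ ℬ) (hinc : 𝒳 ≤ pullback T 1 𝒳)
    {A : ℕ → Set Ω} (hA : ∀ k : ℕ, MeasurableSet[obs T 𝒴 (Set.Iic (k : ℤ))] (A k))
    (m n : ℕ) {g : Ω → ℝ} (hgi : Integrable g μ)
    (hgm : StronglyMeasurable[obs T 𝒴 (Set.Iic 0) ⊔ pullback T m 𝒳] g)
    (hg0 : μ[g | obs T 𝒴 (Set.Iic 0) ⊔ pullback T (-n) 𝒳] =ᵐ[μ] 0) {C : ℝ}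
    (hgC : ∀ᵐ ω ∂μ, |g ω| ≤ C) :
    CesaroNull μ fun k ↦ (A k).indicator fun ω ↦ g (T^[k] ω) := by
  have hTk := measurePreserving_iterate_of_zpow hT
  have hmono := pullback_le_pullback hinc
  have hle : ∀ (k : ℕ) (i : ℤ), obs T 𝒴 (Set.Iic (k : ℤ)) ⊔ pullback T i 𝒳 ≤ ℬ := fun k i ↦
    sup_le (obs_le hT h𝒴 _) (pullback_le_of_le hT h𝒳 _)
  have hcomp : ∀ k : ℕ, StronglyMeasurable[obs T 𝒴 (Set.Iic (k : ℤ)) ⊔ pullback T (m + k) 𝒳]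
      (fun ω ↦ g (T^[k] ω)) := by
    intro k
    have h1 : Measurable[pullback T k (obs T 𝒴 (Set.Iic 0) ⊔ pullback T m 𝒳)]
        (g ∘ ⇑(T ^ (k : ℤ))) := hgm.measurable.comp (comap_measurable _)
    rw [pullback_past, zpow_natCast_eq_iterate] at h1
    exact h1.stronglyMeasurable
  set ξ : ℕ → Ω → ℝ := fun k ↦ (A k).indicator fun ω ↦ g (T^[k] ω) with hξ
  have hξm : ∀ k : ℕ, StronglyMeasurable[obs T 𝒴 (Set.Iic (k : ℤ)) ⊔ pullback T (m + k) 𝒳] (ξ k) :=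
    fun k ↦ (hcomp k).indicator ((le_sup_left : obs T 𝒴 (Set.Iic (k : ℤ)) ≤ _) _ (hA k))
  have hξB : ∀ k : ℕ, AEStronglyMeasurable (ξ k) μ := fun k ↦
    ((hξm k).mono (hle _ _)).aestronglyMeasurable
  have hξC : ∀ k, ∀ᵐ ω ∂μ, |ξ k ω| ≤ C := by
    intro k
    filter_upwards [(hTk k).quasiMeasurePreserving.ae hgC] with ω hω
    by_cases h : ω ∈ A k
    · simpa [hξ, h] using hω
    · simpa [hξ, h] using (abs_nonneg _).trans hω
  refine cesaroNull_of_orthogonal (m + n) hξB hξC fun j k _ hjk ↦ ?_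
  -- From `j + m + n ≤ k` follows `m + j ≤ -n + k`, so `ξ j` belongs to the field given which `g ∘
  -- T^k` has mean zero.
  have hjm : StronglyMeasurable[obs T 𝒴 (Set.Iic (k : ℤ)) ⊔ pullback T (-n + k) 𝒳] (ξ j) := by
    refine (hξm j).mono (sup_le_sup (obs_mono T 𝒴 ?_) (hmono (by omega)))
    exact Set.Iic_subset_Iic.2 (by omega)
  have hym : StronglyMeasurable[obs T 𝒴 (Set.Iic (k : ℤ)) ⊔ pullback T (-n + k) 𝒳]
      ((A k).indicator (ξ j)) :=
    hjm.indicator ((le_sup_left : obs T 𝒴 (Set.Iic (k : ℤ)) ≤ _) _ (hA k))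
  -- The weight `1_{A k}` is moved to the past factor, leaving the unweighted innovation `g ∘ T^k`.
  have heq : (fun ω ↦ ξ j ω * ξ k ω) = fun ω ↦ (A k).indicator (ξ j) ω * g (T^[k] ω) := by
    funext ω
    by_cases h : ω ∈ A k <;> simp [hξ, h]
  have hwi : Integrable (fun ω ↦ g (T^[k] ω)) μ := (hTk k).integrable_comp_of_integrable hgi
  have hprod : Integrable (fun ω ↦ ξ j ω * ξ k ω) μ :=
    Integrable.of_bound ((hξB j).mul (hξB k)) (C * C) (by
      filter_upwards [hξC j, hξC k] with ω h1 h2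
      rw [Real.norm_eq_abs, abs_mul]
      exact mul_le_mul h1 h2 (abs_nonneg _) ((abs_nonneg _).trans h1))
  rw [heq] at hprod ⊢
  refine integral_mul_eq_zero_of_condExp (hle _ _) hym hwi hprod ?_
  have h1 := condExp_comp_ae_eq (hT k) (𝒢 := obs T 𝒴 (Set.Iic 0) ⊔ pullback T (-n) 𝒳)
    (sup_le (obs_le hT h𝒴 _) (pullback_le_of_le hT h𝒳 _)) hgi
  rw [← pullback, pullback_past T 𝒴 𝒳 k (-n), zpow_natCast_eq_iterate] at h1
  exact h1.symm.trans ((hTk k).quasiMeasurePreserving.ae hg0)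

theorem cesaroNull_indicator_innovation [IsProbabilityMeasure μ]
    (hT : ∀ k : ℤ, MeasurePreserving (⇑(T ^ k)) μ μ)
    (h𝒴 : 𝒴 ≤ ℬ) (h𝒳 : 𝒳 ≤ ℬ) (hinc : 𝒳 ≤ pullback T 1 𝒳)
    {A : ℕ → Set Ω} (hA : ∀ k : ℕ, MeasurableSet[obs T 𝒴 (Set.Iic (k : ℤ))] (A k))
    (m n : ℕ) {f : Ω → ℝ} (hfm : StronglyMeasurable[pullback T m 𝒳] f) {C : ℝ}
    (hfC : ∀ᵐ ω ∂μ, |f ω| ≤ C) :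
    CesaroNull μ fun k ↦ (A k).indicator fun ω ↦ f (T^[k] ω) -
      (μ[f | obs T 𝒴 (Set.Iic 0) ⊔ pullback T (-n) 𝒳]) (T^[k] ω) := by
  have hle : obs T 𝒴 (Set.Iic 0) ⊔ pullback T (-n) 𝒳 ≤ ℬ :=
    sup_le (obs_le hT h𝒴 _) (pullback_le_of_le hT h𝒳 _)
  have hf : Integrable f μ := Integrable.of_bound
    (hfm.mono (pullback_le_of_le hT h𝒳 _)).aestronglyMeasurable C hfC
  have hmle : pullback T (-n) 𝒳 ≤ pullback T m 𝒳 := pullback_le_pullback hinc (by omega)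
  have h1 : StronglyMeasurable[obs T 𝒴 (Set.Iic 0) ⊔ pullback T m 𝒳] f := hfm.mono le_sup_right
  have h2 : StronglyMeasurable[obs T 𝒴 (Set.Iic 0) ⊔ pullback T m 𝒳]
      (μ[f | obs T 𝒴 (Set.Iic 0) ⊔ pullback T (-n) 𝒳]) :=
    stronglyMeasurable_condExp.mono (sup_le_sup le_rfl hmle)
  have h3 : ∀ᵐ ω ∂μ, |f ω - (μ[f | obs T 𝒴 (Set.Iic 0) ⊔ pullback T (-n) 𝒳]) ω| ≤ C + C := by
    filter_upwards [hfC, ae_bdd_abs_condExp_of_ae_bdd_abs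
      (m := obs T 𝒴 (Set.Iic 0) ⊔ pullback T (-n) 𝒳) hfC] with ω h1 h2
    exact (abs_sub _ _).trans (add_le_add h1 h2)
  exact cesaroNull_indicator_of_condExp_eq_zero
    (g := fun ω ↦ f ω - (μ[f | obs T 𝒴 (Set.Iic 0) ⊔ pullback T (-n) 𝒳]) ω) hT h𝒴 h𝒳 hinc hA m n
    (hf.sub integrable_condExp) (h1.sub h2) (condExp_sub_condExp_ae_eq_zero hle hf) h3

/-- The factor `2` arises because conditional expectation is an `L¹` contraction. -/
theorem integral_abs_sub_condExp_le {f f' : Ω → ℝ}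
    (hf : Integrable f μ) (hf' : Integrable f' μ) :
    ∫ ω, |(f ω - (μ[f | 𝒵]) ω) - (f' ω - (μ[f' | 𝒵]) ω)| ∂μ ≤ 2 * ∫ ω, |f ω - f' ω| ∂μ := by
  have h1 : ∫ ω, |(f ω - (μ[f | 𝒵]) ω) - (f' ω - (μ[f' | 𝒵]) ω)| ∂μ ≤
      ∫ ω, |f ω - f' ω| + |(μ[f - f' | 𝒵]) ω| ∂μ := by
    refine integral_mono_ae ((hf.sub integrable_condExp).sub (hf'.sub integrable_condExp)).abs
      ((hf.sub hf').abs.add integrable_condExp.abs) ?_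
    filter_upwards [condExp_sub hf hf' 𝒵] with ω hω
    rw [hω, Pi.sub_apply, show (f ω - (μ[f | 𝒵]) ω) - (f' ω - (μ[f' | 𝒵]) ω) =
      (f ω - f' ω) - ((μ[f | 𝒵]) ω - (μ[f' | 𝒵]) ω) by ring]
    exact abs_sub _ _
  refine h1.trans ?_
  refine (integral_add (hf.sub hf').abs integrable_condExp.abs).trans_le ?_
  rw [two_mul]
  exact add_le_add le_rfl (integral_abs_condExp_le _)

/-- Makes the main decomposition stable under `L¹` limits in `f`; it serves both for truncation and
for approximation by functions measurable for a shift of `𝒳`. -/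
theorem cesaroNull_indicator_sub_condExp_of_approx [IsProbabilityMeasure μ] (hT : MeasurePreserving T μ μ) {A : ℕ → Set Ω}
    {f : Ω → ℝ} (hf : Integrable f μ)
    (H : ∀ ε : ℝ, 0 < ε → ∃ f' : Ω → ℝ, Integrable f' μ ∧ ∫ ω, |f ω - f' ω| ∂μ ≤ ε ∧
      CesaroNull μ fun k ↦ (A k).indicator fun ω ↦ f' (T^[k] ω) - (μ[f' | 𝒵]) (T^[k] ω)) :
    CesaroNull μ fun k ↦ (A k).indicator fun ω ↦ f (T^[k] ω) - (μ[f | 𝒵]) (T^[k] ω) := by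
  refine cesaroNull_indicator_of_approx (g := fun ω ↦ f ω - (μ[f | 𝒵]) ω) hT
    (hf.sub integrable_condExp) fun ε hε ↦ ?_
  obtain ⟨f', hf', hle, hnull⟩ := H (ε / 2) (half_pos hε)
  refine ⟨fun ω ↦ f' ω - (μ[f' | 𝒵]) ω, hf'.sub integrable_condExp, ?_, hnull⟩
  refine (integral_abs_sub_condExp_le hf hf').trans ?_
  linarith

theorem _root_.MeasureTheory.Integrable.exists_bounded_approx {f : Ω → ℝ} (hf : Integrable f μ)
    {ε : ℝ} (hε : 0 < ε) :
    ∃ g : Ω → ℝ, Integrable g μ ∧ ∫ ω, |f ω - g ω| ∂μ ≤ ε ∧ ∃ C : ℝ, ∀ ω, |g ω| ≤ C := by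
  obtain ⟨g, hg, hgm⟩ := (memLp_one_iff_integrable.2 hf).exists_simpleFunc_eLpNorm_sub_lt
    ENNReal.one_ne_top (ε := ENNReal.ofReal ε) (by simpa using hε)
  have hgi := memLp_one_iff_integrable.1 hgm
  refine ⟨g, hgi, ?_, g.exists_forall_norm_le⟩
  have h1 : ∫ ω, |f ω - g ω| ∂μ = (eLpNorm (f - ⇑g) 1 μ).toReal := by
    rw [eLpNorm_one_eq_lintegral_enorm, ← integral_norm_eq_lintegral_enorm (hf.sub hgi).1]
    rfl
  rw [h1]
  exact ENNReal.toReal_le_of_le_ofReal hε.le hg.le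

/-- Condition (3) enters here: since the remote fields `Z ∨ T^n 𝒳` shrink to `Z` mod `μ`, the
innovation relative to `Z` is an `L¹` limit of innovations over finite windows. -/
theorem cesaroNull_indicator_sub_condExp_of_bounded_of_measurable [IsProbabilityMeasure μ]
    (hT : ∀ k : ℤ, MeasurePreserving (⇑(T ^ k)) μ μ) (h𝒴 : 𝒴 ≤ ℬ) (h𝒳 : 𝒳 ≤ ℬ)
    (hinc : 𝒳 ≤ pullback T 1 𝒳)
    (htail : LEMod (⨅ k : ℤ, ⨅ _ : 1 ≤ k, obs T 𝒴 (Set.Iic 0) ⊔ pullback T (-k) 𝒳)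
      (obs T 𝒴 (Set.Iic 0)) μ)
    {A : ℕ → Set Ω} (hA : ∀ k : ℕ, MeasurableSet[obs T 𝒴 (Set.Iic (k : ℤ))] (A k)) (m : ℕ)
    {f : Ω → ℝ} (hfm : StronglyMeasurable[pullback T m 𝒳] f) {C : ℝ}
    (hfC : ∀ᵐ ω ∂μ, |f ω| ≤ C) :
    CesaroNull μ fun k ↦ (A k).indicator fun ω ↦ f (T^[k] ω) -
      (μ[f | obs T 𝒴 (Set.Iic 0)]) (T^[k] ω) := by
  have hT1 : MeasurePreserving (⇑T) μ μ := by simpa using hT 1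
  have hmono := pullback_le_pullback hinc
  have h𝒵 : obs T 𝒴 (Set.Iic 0) ≤ ℬ := obs_le hT h𝒴 _
  have hfB : AEStronglyMeasurable f μ :=
    (hfm.mono (pullback_le_of_le hT h𝒳 _)).aestronglyMeasurable
  have hf2 : MemLp f 2 μ := MemLp.of_bound hfB C hfC
  have hf : Integrable f μ := Integrable.of_bound hfB C hfC
  -- The shift is `n + 1` because the intersection in condition (3) starts at `1`.
  let G : ℕ → MeasurableSpace Ω :=
    fun n ↦ obs T 𝒴 (Set.Iic 0) ⊔ pullback T (-((n + 1 : ℕ) : ℤ)) 𝒳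
  have hGanti : Antitone G := fun a b hab ↦ sup_le_sup le_rfl (hmono (by push_cast; omega))
  have hGB : ∀ n, G n ≤ ℬ := fun n ↦ sup_le h𝒵 (pullback_le_of_le hT h𝒳 _)
  have hGinf : ⨅ n, G n = ⨅ k : ℤ, ⨅ _ : 1 ≤ k, obs T 𝒴 (Set.Iic 0) ⊔ pullback T (-k) 𝒳 := by
    refine le_antisymm (le_iInf₂ fun k hk ↦ ?_) (le_iInf fun n ↦ iInf₂_le _ (by omega))
    refine (iInf_le G (k.toNat - 1)).trans (le_of_eq ?_)
    simp only [G]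
    congr 3
    omega
  have hE : μ[f | ⨅ n, G n] =ᵐ[μ] μ[f | obs T 𝒴 (Set.Iic 0)] :=
    condExp_ae_eq_of_leMod (le_iInf fun n ↦ le_sup_left) ((iInf_le G 0).trans (hGB 0))
      (hGinf ▸ htail) hf
  have hlim := tendsto_integral_abs_condExp_iInf hGanti hGB hf2
  refine cesaroNull_indicator_of_approx (g := fun ω ↦ f ω - (μ[f | obs T 𝒴 (Set.Iic 0)]) ω) hT1
    (hf.sub integrable_condExp) fun ε hε ↦ ?_
  obtain ⟨n, hn⟩ := ((tendsto_order.1 hlim).2 ε hε).exists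
  refine ⟨fun ω ↦ f ω - (μ[f | G n]) ω, hf.sub integrable_condExp, le_of_eq_of_le ?_ hn.le,
    cesaroNull_indicator_innovation hT h𝒴 h𝒳 hinc hA m (n + 1) hfm hfC⟩
  refine integral_congr_ae ?_
  filter_upwards [hE] with ω hω
  rw [hω, sub_sub_sub_cancel_left]

/-- Lévy's upward theorem along the increasing σ-fields `T ^ (-k) 𝒳` when they generate `ℬ`. -/
theorem tendsto_integral_abs_sub_condExp_pullback [IsProbabilityMeasure μ]
    (hT : ∀ k : ℤ, MeasurePreserving (⇑(T ^ k)) μ μ) (h𝒳 : 𝒳 ≤ ℬ) (hinc : 𝒳 ≤ pullback T 1 𝒳)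
    (hgen : LEMod ℬ (⨆ k : ℤ, ⨆ _ : 1 ≤ k, pullback T k 𝒳) μ) {f : Ω → ℝ}
    (hf : Integrable f μ) :
    Tendsto (fun n : ℕ ↦ ∫ ω, |f ω - (μ[f | pullback T ((n + 1 : ℕ) : ℤ) 𝒳]) ω| ∂μ) atTop
      (𝓝 0) := by
  let ℱ : Filtration ℕ ℬ :=
    { seq := fun n ↦ pullback T ((n + 1 : ℕ) : ℤ) 𝒳
      mono' := fun a b hab ↦ pullback_le_pullback hinc (by push_cast; omega)
      le' := fun n ↦ pullback_le_of_le hT h𝒳 _ }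
  have hsup : ⨆ n, ℱ n = ⨆ k : ℤ, ⨆ _ : 1 ≤ k, pullback T k 𝒳 := by
    refine le_antisymm (iSup_le fun n ↦ ?_) (iSup₂_le fun k hk ↦ ?_)
    · exact le_iSup₂_of_le (f := fun (k : ℤ) (_ : 1 ≤ k) ↦ pullback T k 𝒳)
        ((n + 1 : ℕ) : ℤ) (by omega) le_rfl
    · refine le_trans (le_of_eq ?_) (le_iSup (fun n ↦ ℱ n) (k.toNat - 1))
      change _ = pullback T _ 𝒳
      congr
      omega
  have hE : μ[f | ⨆ n, ℱ n] =ᵐ[μ] f :=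
    condExp_self_of_leMod (iSup_le fun n ↦ ℱ.le n) (hsup ▸ hgen) hf
  have hlim := (ENNReal.tendsto_toReal ENNReal.zero_ne_top).comp
    (tendsto_eLpNorm_condExp (ℱ := ℱ) (μ := μ) f)
  refine Tendsto.congr (fun n ↦ ?_) hlim
  have hi : Integrable (μ[f | ℱ n] - μ[f | ⨆ n, ℱ n]) μ :=
    integrable_condExp.sub integrable_condExp
  rw [Function.comp_apply, eLpNorm_one_eq_lintegral_enorm,
    ← integral_norm_eq_lintegral_enorm hi.1]
  refine integral_congr_ae ?_
  filter_upwards [hE] with ω hω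
  rw [Pi.sub_apply, hω, Real.norm_eq_abs, abs_sub_comm]

/-- On a conditional `K`-automorphism, the weighted averages of `f ∘ T ^ k` and of its conditional
expectation given the infinite observation past are asymptotically equal, for weights that are
indicators of events in that past. -/
theorem cesaroNull_indicator_sub_condExp [IsProbabilityMeasure μ]
    (hT : ∀ k : ℤ, MeasurePreserving (⇑(T ^ k)) μ μ)
    (h𝒴 : 𝒴 ≤ ℬ) (hK : IsCondKAutomorphism (obs T 𝒴 (Set.Iic 0)) μ T)
    {A : ℕ → Set Ω} (hA : ∀ k : ℕ, MeasurableSet[obs T 𝒴 (Set.Iic (k : ℤ))] (A k))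
    {f : Ω → ℝ} (hf : Integrable f μ) :
    CesaroNull μ fun k ↦ (A k).indicator fun ω ↦ f (T^[k] ω) -
      (μ[f | obs T 𝒴 (Set.Iic 0)]) (T^[k] ω) := by
  have hT1 : MeasurePreserving (⇑T) μ μ := by simpa using hT 1
  refine cesaroNull_indicator_sub_condExp_of_approx hT1 hf fun ε hε ↦ ?_
  obtain ⟨g, hgi, hle, C, hC⟩ := hf.exists_bounded_approx hε
  refine ⟨g, hgi, hle, ?_⟩
  obtain ⟨-, 𝒳, h𝒳, hinc, ⟨-, hgen⟩, htail, -⟩ := hK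
  have hlim := tendsto_integral_abs_sub_condExp_pullback hT h𝒳 hinc hgen hgi
  refine cesaroNull_indicator_sub_condExp_of_approx hT1 hgi fun δ hδ ↦ ?_
  obtain ⟨n, hn⟩ := ((tendsto_order.1 hlim).2 δ hδ).exists
  exact ⟨_, integrable_condExp, hn.le,
    cesaroNull_indicator_sub_condExp_of_bounded_of_measurable hT h𝒴 h𝒳 hinc htail hA (n + 1)
      stronglyMeasurable_condExp (ae_bdd_abs_condExp_of_ae_bdd_abs (Eventually.of_forall hC))⟩

end Decomposition

/-! ### Finite action spaces and measurable selection. -/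

section FiniteDecisions

variable {Ω U : Type*}

/-- In a finite measurable space one can choose, measurably for the discrete σ-field, a
representative of the atom of each point. -/
theorem exists_atom_representative (U : Type*) [MeasurableSpace U] [Finite U] :
    ∃ r : U → U, (∀ S : Set U, MeasurableSet (r ⁻¹' S)) ∧
      ∀ f : U → ℝ, Measurable f → ∀ u, f (r u) = f u := by
  have hne : ∀ u : U, (measurableAtom u).Nonempty := fun u ↦ ⟨u, mem_measurableAtom_self u⟩
  have hmeas : ∀ u : U, MeasurableSet (measurableAtom u) :=
    MeasurableSet.measurableAtom_of_countable
  have heq : ∀ u v : U, v ∈ measurableAtom u → measurableAtom v = measurableAtom u := by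
    intro u v hv
    refine Set.Subset.antisymm (measurableAtom_subset (hmeas u) hv) ?_
    have hu : u ∈ measurableAtom v := by
      by_contra hu
      exact (measurableAtom_subset ((hmeas u).diff (hmeas v)) ⟨mem_measurableAtom_self u, hu⟩ hv).2
        (mem_measurableAtom_self v)
    exact measurableAtom_subset (hmeas v) hu
  refine ⟨fun u ↦ (hne u).some, fun S ↦ ?_, fun f hf u ↦ ?_⟩
  · have hr : ∀ u v : U, v ∈ measurableAtom u → (hne v).some = (hne u).some := by
      intro u v hv
      congr 1
      exact heq u v hv
    have : (fun u ↦ (hne u).some) ⁻¹' S =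
        ⋃ u ∈ (fun u ↦ (hne u).some) ⁻¹' S, measurableAtom u := by
      ext v
      simp only [Set.mem_iUnion]
      refine ⟨fun hv ↦ ⟨v, hv, mem_measurableAtom_self v⟩, ?_⟩
      rintro ⟨u, hu, hv⟩
      change (hne v).some ∈ S
      rw [hr u v hv]
      exact hu
    rw [this]
    exact MeasurableSet.biUnion (Set.to_countable _) fun u _ ↦ hmeas u
  · exact mem_of_mem_measurableAtom (hne u).some_mem (hf (measurableSet_singleton (f u))) rfl

/-- The set of minimizers takes finitely many values, so a fixed choice from each possible set is a
measurable selection, even for the discrete σ-field on `U`. -/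
theorem exists_measurable_argmin [Finite U] [Nonempty U] {𝒢 : MeasurableSpace Ω}
    {c : U → Ω → ℝ} (hc : ∀ a, Measurable (c a)) :
    ∃ w : Ω → U, (∀ S : Set U, MeasurableSet (w ⁻¹' S)) ∧ ∀ ω a, c (w ω) ω ≤ c a ω := by
  classical
  set M : Ω → Set U := fun ω ↦ {a | ∀ b, c a ω ≤ c b ω} with hM
  have hMne : ∀ ω, (M ω).Nonempty := fun ω ↦ by
    obtain ⟨a, ha⟩ := Finite.exists_min fun a ↦ c a ω
    exact ⟨a, ha⟩
  obtain ⟨p, hp⟩ : ∃ p : Set U → U, ∀ s : Set U, s.Nonempty → p s ∈ s :=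
    ⟨fun s ↦ if h : s.Nonempty then h.some else Classical.arbitrary U, fun s hs ↦ by
      simp only [hs, dif_pos]; exact hs.some_mem⟩
  have hmem : ∀ a, MeasurableSet {ω | a ∈ M ω} := fun a ↦ by
    have : {ω | a ∈ M ω} = ⋂ b, {ω | c a ω ≤ c b ω} := by
      ext ω; simp [hM]
    rw [this]
    exact MeasurableSet.iInter fun b ↦ measurableSet_le (hc a) (hc b)
  have hMs : ∀ s : Set U, MeasurableSet {ω | M ω = s} := fun s ↦ by
    have : {ω | M ω = s} = ⋂ a, if a ∈ s then {ω | a ∈ M ω} else {ω | a ∈ M ω}ᶜ := by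
      ext ω
      simp only [Set.mem_iInter]
      constructor
      · rintro rfl a
        split_ifs with h <;> exact h
      · intro h
        change M ω = s
        ext a
        have := h a
        split_ifs at this with ha
        · exact ⟨fun _ ↦ ha, fun _ ↦ this⟩
        · exact ⟨fun h' ↦ absurd h' this, fun h' ↦ absurd h' ha⟩
    rw [this]
    refine MeasurableSet.iInter fun a ↦ ?_
    split_ifs
    exacts [hmem a, (hmem a).compl]
  refine ⟨fun ω ↦ p (M ω), fun S ↦ ?_, fun ω a ↦ hp _ (hMne ω) a⟩
  have : (fun ω ↦ p (M ω)) ⁻¹' S = ⋃ s ∈ p ⁻¹' S, {ω | M ω = s} := by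
    ext ω
    simp
  rw [this]
  exact MeasurableSet.biUnion (Set.to_countable _) fun s _ ↦ hMs s

theorem eq_sum_indicator_preimage [Fintype U] (w : Ω → U) (F : U → Ω → ℝ) (ω : Ω) :
    F (w ω) ω = ∑ a, (w ⁻¹' {a}).indicator (F a) ω := by
  classical
  rw [Finset.sum_eq_single (w ω)]
  · simp
  · intro a _ ha
    have h : ω ∉ w ⁻¹' {a} := fun h ↦ ha (Set.mem_singleton_iff.1 h).symm
    exact Set.indicator_of_notMem h _
  · simp

/-- Conditional expectation of a loss whose decision is known. -/
theorem condExp_decision {𝒢 ℬ : MeasurableSpace Ω} {μ : Measure Ω} [IsProbabilityMeasure μ]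
    [Finite U] (h𝒢 : 𝒢 ≤ ℬ) {w : Ω → U} (hw : ∀ S : Set U, MeasurableSet[𝒢] (w ⁻¹' S))
    {F : U → Ω → ℝ} (hF : ∀ a, Integrable (F a) μ) :
    μ[fun ω ↦ F (w ω) ω | 𝒢] =ᵐ[μ] fun ω ↦ (μ[F (w ω) | 𝒢]) ω := by
  cases nonempty_fintype U
  have h1 : (fun ω ↦ F (w ω) ω) = ∑ a, (w ⁻¹' {a}).indicator (F a) := by
    funext ω
    rw [eq_sum_indicator_preimage w F, Finset.sum_apply]
  rw [h1]
  refine (condExp_finsetSum (fun a _ ↦ (hF a).indicator (h𝒢 _ (hw {a}))) 𝒢).trans ?_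
  have h2 : ∀ᵐ ω ∂μ, ∀ a, (μ[(w ⁻¹' {a}).indicator (F a) | 𝒢]) ω =
      (w ⁻¹' {a}).indicator (μ[F a | 𝒢]) ω :=
    ae_all_iff.2 fun a ↦ condExp_indicator (hF a) (hw {a})
  filter_upwards [h2] with ω hω
  rw [Finset.sum_apply, eq_sum_indicator_preimage w (fun a ↦ μ[F a | 𝒢])]
  exact Finset.sum_congr rfl fun a _ ↦ hω a

end FiniteDecisions

/-! ### From finite to infinite observation past. -/

section Optimality

variable {Ω U : Type*} {𝒴 ℬ : MeasurableSpace Ω} {μ : Measure Ω} {T : Equiv.Perm Ω}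

theorem measurePreserving_zpow (hT : MeasurePreserving (⇑T) μ μ) (hT' : Measurable (⇑T.symm))
    (k : ℤ) : MeasurePreserving (⇑(T ^ k)) μ μ := by
  have hinv : MeasurePreserving (⇑T⁻¹) μ μ :=
    MeasurePreserving.symm (e := ⟨T, hT.measurable, hT'⟩) hT
  cases k with
  | ofNat n =>
    rw [Int.ofNat_eq_natCast, zpow_natCast_eq_iterate]
    exact hT.iterate n
  | negSucc n =>
    rw [zpow_negSucc, ← inv_pow, Equiv.Perm.coe_pow]
    exact hinv.iterate (n + 1)

theorem iSup_obs_Icc (T : Equiv.Perm Ω) (𝒴 : MeasurableSpace Ω) :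
    ⨆ n : ℕ, obs T 𝒴 (Set.Icc (-(n : ℤ)) 0) = obs T 𝒴 (Set.Iic 0) := by
  refine le_antisymm (iSup_le fun n ↦ obs_mono T 𝒴 fun i hi ↦ hi.2) (iSup₂_le fun i hi ↦ ?_)
  refine le_trans ?_ (le_iSup _ (-i).toNat)
  exact le_iSup₂_of_le (f := fun (k : ℤ) (_ : k ∈ Set.Icc (-((-i).toNat : ℤ)) 0) ↦ pullback T k 𝒴)
    i ⟨by omega, hi⟩ le_rfl

theorem tendsto_ae_condExp_obs_Icc [IsProbabilityMeasure μ]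
    (hT : ∀ k : ℤ, MeasurePreserving (⇑(T ^ k)) μ μ) (h𝒴 : 𝒴 ≤ ℬ) (f : Ω → ℝ) :
    ∀ᵐ ω ∂μ, Tendsto (fun n : ℕ ↦ (μ[f | obs T 𝒴 (Set.Icc (-(n : ℤ)) 0)]) ω) atTop
      (𝓝 ((μ[f | obs T 𝒴 (Set.Iic 0)]) ω)) := by
  let ℱ : Filtration ℕ ℬ :=
    { seq := fun n ↦ obs T 𝒴 (Set.Icc (-(n : ℤ)) 0)
      mono' := fun a b hab ↦ obs_mono T 𝒴 (Set.Icc_subset_Icc_left (by omega))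
      le' := fun n ↦ obs_le hT h𝒴 _ }
  have h := tendsto_ae_condExp (ℱ := ℱ) (μ := μ) f
  have hsup : ⨆ n, ℱ n = obs T 𝒴 (Set.Iic 0) := iSup_obs_Icc T 𝒴
  rw [hsup] at h
  exact h

/-- Stationarity trades observations on `[0, k]` for observations on `[-k, 0]`, which increase with
`k`, so that martingale convergence applies. -/
theorem condExp_comp_iterate_obs [IsProbabilityMeasure μ]
    (hT : ∀ k : ℤ, MeasurePreserving (⇑(T ^ k)) μ μ) (h𝒴 : 𝒴 ≤ ℬ) {f : Ω → ℝ}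
    (hf : Integrable f μ) (k : ℕ) :
    μ[fun ω ↦ f (T^[k] ω) | obs T 𝒴 (Set.Icc 0 (k : ℤ))] =ᵐ[μ]
      fun ω ↦ (μ[f | obs T 𝒴 (Set.Icc (-(k : ℤ)) 0)]) (T^[k] ω) := by
  have h := condExp_comp_ae_eq (hT k) (𝒢 := obs T 𝒴 (Set.Icc (-(k : ℤ)) 0)) (obs_le hT h𝒴 _) hf
  rw [← pullback, pullback_obs T 𝒴 k (Set.Icc (-(k : ℤ)) 0) (Set.Icc 0 (k : ℤ)) (fun i ↦ by
    simp only [Set.mem_Icc]; omega), zpow_natCast_eq_iterate] at h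
  exact h.symm

theorem ae_zero_le_liminf_of_cesaroNull_le {X N : ℕ → Ω → ℝ} (hN : CesaroNull μ N)
    (h : ∀ k, 1 ≤ k → ∀ᵐ ω ∂μ, N k ω ≤ X k ω) :
    ∀ᵐ ω ∂μ, (0 : EReal) ≤ liminf (fun n : ℕ ↦
      (((n : ℝ)⁻¹ * ∑ k ∈ Finset.Icc 1 n, X k ω : ℝ) : EReal)) atTop := by
  have h' : ∀ᵐ ω ∂μ, ∀ k, 1 ≤ k → N k ω ≤ X k ω := by
    rw [ae_all_iff]; intro k
    by_cases hk : 1 ≤ k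
    · filter_upwards [h k hk] with ω hω _ using hω
    · simp [hk]
  filter_upwards [hN, h'] with ω h1 h2
  have h3 : Tendsto (fun n : ℕ ↦ (((n : ℝ)⁻¹ * ∑ k ∈ Finset.Icc 1 n, N k ω : ℝ) : EReal)) atTop
      (𝓝 ((0 : ℝ) : EReal)) := (continuous_coe_real_ereal.tendsto 0).comp h1
  rw [← EReal.coe_zero, ← h3.liminf_eq]
  refine liminf_le_liminf (Eventually.of_forall fun n ↦ ?_)
  refine EReal.coe_le_coe_iff.2 (mul_le_mul_of_nonneg_left ?_ (by positivity))
  exact Finset.sum_le_sum fun k hk ↦ h2 k (Finset.mem_Icc.1 hk).1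

/-- The positive part of `E[b - a | 𝒴_{-∞,0}]` on the event that `b` looks almost at least as good
as `a` given only `𝒴_{-k,0}`. -/
def regret {ℬ : MeasurableSpace Ω} (μ : Measure Ω) (T : Equiv.Perm Ω) (𝒴 : MeasurableSpace Ω)
    (a b : Ω → ℝ) (k : ℕ) : Ω → ℝ :=
  {ω | (μ[b | obs T 𝒴 (Set.Icc (-(k : ℤ)) 0)]) ω ≤
    (μ[a | obs T 𝒴 (Set.Icc (-(k : ℤ)) 0)]) ω + (k : ℝ)⁻¹}.indicator
    fun ω ↦ max ((μ[b | obs T 𝒴 (Set.Iic 0)]) ω - (μ[a | obs T 𝒴 (Set.Iic 0)]) ω) 0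

theorem regret_nonneg (a b : Ω → ℝ) (k : ℕ) (ω : Ω) : 0 ≤ regret μ T 𝒴 a b k ω :=
  Set.indicator_nonneg (fun _ _ ↦ le_max_right _ _) _

/-- At almost every point the regret is eventually zero: either the positive part vanishes, or the
strict inequality between the limits eventually excludes the event. Maker's theorem then applies,
with the absolute difference of the limits as dominating function. -/
theorem cesaroNull_regret [IsProbabilityMeasure μ]
    (hT : ∀ k : ℤ, MeasurePreserving (⇑(T ^ k)) μ μ) (h𝒴 : 𝒴 ≤ ℬ) (a b : Ω → ℝ) :
    CesaroNull μ fun k ω ↦ regret μ T 𝒴 a b k (T^[k] ω) := by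
  have hT1 : MeasurePreserving (⇑T) μ μ := by simpa using hT 1
  have hsm : ∀ (I : Set ℤ) (f : Ω → ℝ), StronglyMeasurable (μ[f | obs T 𝒴 I]) := fun I f ↦
    stronglyMeasurable_condExp.mono (obs_le hT h𝒴 _)
  refine cesaroNull_of_dominated (φ := regret μ T 𝒴 a b)
    (g := fun ω ↦ |(μ[b | obs T 𝒴 (Set.Iic 0)]) ω - (μ[a | obs T 𝒴 (Set.Iic 0)]) ω|) hT1
    (integrable_condExp.sub integrable_condExp).abs ?_ ?_ ?_
  · intro k
    refine StronglyMeasurable.aestronglyMeasurable (StronglyMeasurable.indicator ?_ ?_)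
    · exact ((hsm _ b).sub (hsm _ a)).sup stronglyMeasurable_const
    · exact measurableSet_le (hsm _ b).measurable ((hsm _ a).measurable.add_const _)
  · refine fun k _ ↦ Eventually.of_forall fun ω ↦ ?_
    rw [abs_of_nonneg (regret_nonneg a b k ω)]
    exact (Set.indicator_le_self' (fun _ _ ↦ le_max_right _ _) ω).trans
      (max_le (le_abs_self _) (abs_nonneg _))
  · filter_upwards [tendsto_ae_condExp_obs_Icc hT h𝒴 a, tendsto_ae_condExp_obs_Icc hT h𝒴 b]
      with ω ha hb
    rcases le_or_gt ((μ[b | obs T 𝒴 (Set.Iic 0)]) ω) ((μ[a | obs T 𝒴 (Set.Iic 0)]) ω) with h | h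
    · refine tendsto_const_nhds.congr fun k ↦ ?_
      refine le_antisymm (regret_nonneg a b k ω)
        ((Set.indicator_le_self' (fun _ _ ↦ le_max_right _ _) ω).trans (max_le ?_ le_rfl))
      linarith
    · have hlim := ha.add (tendsto_inv_atTop_nhds_zero_nat (𝕜 := ℝ))
      rw [add_zero] at hlim
      refine tendsto_const_nhds.congr' ?_
      filter_upwards [hlim.eventually_lt hb h] with k hk
      have hmem : ω ∉ {ω | (μ[b | obs T 𝒴 (Set.Icc (-(k : ℤ)) 0)]) ω ≤
          (μ[a | obs T 𝒴 (Set.Icc (-(k : ℤ)) 0)]) ω + (k : ℝ)⁻¹} := not_le.2 hk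
      exact (Set.indicator_of_notMem hmem _).symm

end Optimality

/-! ### Existence and pathwise optimality of mean-optimal strategies. -/

section MainResult

variable {Ω U : Type*} [MeasurableSpace U] {𝒴 ℬ : MeasurableSpace Ω} {μ : Measure Ω}
  {T : Equiv.Perm Ω} {ℓ : U → Ω → ℝ} {r : U → U}

theorem integrable_loss (hℓ : Measurable (Function.uncurry ℓ)) (hdom : IsDominated μ ℓ) (a : U) :
    Integrable (ℓ a) μ := by
  obtain ⟨Λ, hΛ, hb⟩ := hdom
  exact hΛ.mono' (hℓ.comp measurable_prodMk_left).aestronglyMeasurable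
    (Eventually.of_forall fun ω ↦ hb a ω)

theorem lossAt_eq {U : Type*} (T : Equiv.Perm Ω) (ℓ : U → Ω → ℝ) (k : ℕ) (v : Ω → U) :
    lossAt T ℓ k v = fun ω ↦ ℓ (v ω) (T^[k] ω) := by
  funext ω
  rw [lossAt, Equiv.Perm.coe_pow]

/-- Singletons of `U` need not be measurable. A measurable loss cannot separate points of one atom,
so `v` may be replaced by `r ∘ v`, whose level sets are events. -/
theorem lossAt_eq_representative (hℓ : Measurable (Function.uncurry ℓ))
    (hr : ∀ f : U → ℝ, Measurable f → ∀ u, f (r u) = f u) (k : ℕ) (v : Ω → U) :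
    lossAt T ℓ k v = fun ω ↦ ℓ (r (v ω)) (T^[k] ω) := by
  rw [lossAt_eq]
  funext ω
  exact (hr (fun a ↦ ℓ a (T^[k] ω)) (hℓ.comp measurable_prodMk_right) (v ω)).symm

/-- The conditional expected loss of a decision, in terms of those of the constant decisions. -/
theorem condExp_lossAt [IsProbabilityMeasure μ] [Finite U]
    (hT : ∀ k : ℤ, MeasurePreserving (⇑(T ^ k)) μ μ) (h𝒴 : 𝒴 ≤ ℬ)
    (hℓ : Measurable (Function.uncurry ℓ)) (hdom : IsDominated μ ℓ)
    (hrm : ∀ S : Set U, MeasurableSet (r ⁻¹' S))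
    (hr : ∀ f : U → ℝ, Measurable f → ∀ u, f (r u) = f u) (k : ℕ) {v : Ω → U}
    (hv : v ∈ Decisions U (obs T 𝒴 (Set.Icc 0 (k : ℤ)))) :
    μ[lossAt T ℓ k v | obs T 𝒴 (Set.Icc 0 (k : ℤ))] =ᵐ[μ] fun ω ↦
      (μ[fun ω' ↦ ℓ (r (v ω)) (T^[k] ω') | obs T 𝒴 (Set.Icc 0 (k : ℤ))]) ω := by
  rw [lossAt_eq_representative hℓ hr]
  exact condExp_decision (F := fun a ω ↦ ℓ a (T^[k] ω)) (w := fun ω ↦ r (v ω)) (obs_le hT h𝒴 _)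
    (fun S ↦ hv (hrm S)) fun a ↦
      (measurePreserving_iterate_of_zpow hT k).integrable_comp_of_integrable
        (integrable_loss hℓ hdom a)

/-- With finitely many actions the conditional expected loss has a measurable minimizer, so the
essential infimum is attained and the slack `1 / k` is not needed. -/
theorem exists_isMeanOptimal [IsProbabilityMeasure μ] [Finite U] [Nonempty U]
    (hT : ∀ k : ℤ, MeasurePreserving (⇑(T ^ k)) μ μ) (h𝒴 : 𝒴 ≤ ℬ)
    (hℓ : Measurable (Function.uncurry ℓ)) (hdom : IsDominated μ ℓ) :
    ∃ u : ℕ → Ω → U, IsMeanOptimal 𝒴 μ T ℓ u := by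
  obtain ⟨r, hrm, hr⟩ := exists_atom_representative U
  have harg : ∀ k : ℕ, ∃ w : Ω → U,
      (∀ S : Set U, MeasurableSet[obs T 𝒴 (Set.Icc 0 (k : ℤ))] (w ⁻¹' S)) ∧
      ∀ ω a, (μ[fun ω' ↦ ℓ (w ω) (T^[k] ω') | obs T 𝒴 (Set.Icc 0 (k : ℤ))]) ω ≤
        (μ[fun ω' ↦ ℓ a (T^[k] ω') | obs T 𝒴 (Set.Icc 0 (k : ℤ))]) ω := fun k ↦
    exists_measurable_argmin
      (c := fun a ↦ μ[fun ω' ↦ ℓ a (T^[k] ω') | obs T 𝒴 (Set.Icc 0 (k : ℤ))])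
      fun _ ↦ stronglyMeasurable_condExp.measurable
  choose w hwm hwle using harg
  have hadm : ∀ k : ℕ, w k ∈ Decisions U (obs T 𝒴 (Set.Icc 0 (k : ℤ))) := fun k S _ ↦ hwm k S
  refine ⟨w, fun k _ ↦ hadm k, fun k _ ↦
    ⟨μ[lossAt T ℓ k (w k) | obs T 𝒴 (Set.Icc 0 (k : ℤ))],
      ⟨integrable_condExp.aemeasurable, fun v ↦ ?_, fun h _ hle ↦ hle ⟨w k, hadm k⟩⟩, ?_⟩⟩
  · have hw : μ[lossAt T ℓ k (w k) | obs T 𝒴 (Set.Icc 0 (k : ℤ))] =ᵐ[μ] fun ω ↦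
        (μ[fun ω' ↦ ℓ (w k ω) (T^[k] ω') | obs T 𝒴 (Set.Icc 0 (k : ℤ))]) ω := by
      rw [lossAt_eq]
      exact condExp_decision (F := fun a ω ↦ ℓ a (T^[k] ω)) (obs_le hT h𝒴 _) (hwm k) fun a ↦
        (measurePreserving_iterate_of_zpow hT k).integrable_comp_of_integrable
          (integrable_loss hℓ hdom a)
    filter_upwards [hw, condExp_lossAt hT h𝒴 hℓ hdom hrm hr k v.2] with ω h1 h2
    rw [h1, h2]
    exact hwle k ω _
  · refine Eventually.of_forall fun ω ↦ ?_
    have : (0 : ℝ) ≤ (k : ℝ)⁻¹ := by positivity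
    linarith

/-- A mean-optimal decision is, given the observations since time zero, almost as good as any other
admissible decision; seen from time `k` the observations are those since time `-k`. -/
theorem IsMeanOptimal.condExp_le [IsProbabilityMeasure μ] [Finite U]
    (hT : ∀ k : ℤ, MeasurePreserving (⇑(T ^ k)) μ μ) (h𝒴 : 𝒴 ≤ ℬ)
    (hℓ : Measurable (Function.uncurry ℓ)) (hdom : IsDominated μ ℓ)
    (hrm : ∀ S : Set U, MeasurableSet (r ⁻¹' S))
    (hr : ∀ f : U → ℝ, Measurable f → ∀ u, f (r u) = f u) {u : ℕ → Ω → U}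
    (hu : IsMeanOptimal 𝒴 μ T ℓ u) {k : ℕ} (hk : 1 ≤ k) {v : Ω → U}
    (hv : v ∈ Decisions U (obs T 𝒴 (Set.Icc 0 (k : ℤ)))) :
    ∀ᵐ ω ∂μ, (μ[ℓ (r (u k ω)) | obs T 𝒴 (Set.Icc (-(k : ℤ)) 0)]) (T^[k] ω) ≤
      (μ[ℓ (r (v ω)) | obs T 𝒴 (Set.Icc (-(k : ℤ)) 0)]) (T^[k] ω) + (k : ℝ)⁻¹ := by
  obtain ⟨g, ⟨-, hgle, -⟩, hug⟩ := hu.2 k hk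
  have hcomp : ∀ᵐ ω ∂μ, ∀ a, (μ[fun ω' ↦ ℓ a (T^[k] ω') | obs T 𝒴 (Set.Icc 0 (k : ℤ))]) ω =
      (μ[ℓ a | obs T 𝒴 (Set.Icc (-(k : ℤ)) 0)]) (T^[k] ω) :=
    ae_all_iff.2 fun a ↦ condExp_comp_iterate_obs hT h𝒴 (integrable_loss hℓ hdom a) k
  filter_upwards [hcomp, hug, hgle ⟨v, hv⟩, condExp_lossAt hT h𝒴 hℓ hdom hrm hr k hv,
    condExp_lossAt hT h𝒴 hℓ hdom hrm hr k (hu.1 k hk)] with ω h1 h2 h3 h4 h5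
  rw [← h1, ← h1, ← h4, ← h5]
  linarith

/-- Losses and their conditional expectations given the infinite observation past have
asymptotically equal averages along admissible decisions. -/
theorem cesaroNull_loss_sub_condExp [IsProbabilityMeasure μ] [Fintype U]
    (hT : ∀ k : ℤ, MeasurePreserving (⇑(T ^ k)) μ μ) (h𝒴 : 𝒴 ≤ ℬ)
    (hK : IsCondKAutomorphism (obs T 𝒴 (Set.Iic 0)) μ T)
    (hℓ : Measurable (Function.uncurry ℓ)) (hdom : IsDominated μ ℓ)
    (hrm : ∀ S : Set U, MeasurableSet (r ⁻¹' S)) {v : ℕ → Ω → U} (hv : IsAdmissible 𝒴 T v) :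
    CesaroNull μ fun k ω ↦ ℓ (r (v k ω)) (T^[k] ω) -
      (μ[ℓ (r (v k ω)) | obs T 𝒴 (Set.Iic 0)]) (T^[k] ω) := by
  have hA : ∀ (a : U) (k : ℕ), MeasurableSet[obs T 𝒴 (Set.Iic (k : ℤ))]
      -- Admissibility says nothing about time `0`, so the event there is set to be empty.
      (if 1 ≤ k then (fun ω ↦ r (v k ω)) ⁻¹' {a} else ∅) := by
    intro a k
    split_ifs with hk
    · exact obs_mono T 𝒴 Set.Icc_subset_Iic_self _ (hv k hk (hrm {a}))
    · exact @MeasurableSet.empty _ (_)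
  refine (CesaroNull.sum Finset.univ fun a _ ↦ cesaroNull_indicator_sub_condExp hT h𝒴 hK (hA a)
    (integrable_loss hℓ hdom a)).congr fun k hk ↦ Eventually.of_forall fun ω ↦ ?_
  simp only [hk, if_true]
  exact (eq_sum_indicator_preimage (fun ω ↦ r (v k ω)) (fun a ω ↦ ℓ a (T^[k] ω) -
    (μ[ℓ a | obs T 𝒴 (Set.Iic 0)]) (T^[k] ω)) ω).symm

theorem IsMeanOptimal.isPathwiseOptimal [IsProbabilityMeasure μ] [Finite U]
    (hT : ∀ k : ℤ, MeasurePreserving (⇑(T ^ k)) μ μ) (h𝒴 : 𝒴 ≤ ℬ)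
    (hK : IsCondKAutomorphism (obs T 𝒴 (Set.Iic 0)) μ T)
    (hℓ : Measurable (Function.uncurry ℓ)) (hdom : IsDominated μ ℓ) {u : ℕ → Ω → U}
    (hu : IsMeanOptimal 𝒴 μ T ℓ u) : IsPathwiseOptimal 𝒴 μ T ℓ u := by
  cases nonempty_fintype U
  obtain ⟨r, hrm, hr⟩ := exists_atom_representative U
  refine ⟨hu.1, fun v hv ↦ ?_⟩
  -- The loss difference is the difference of the two innovations plus the difference of conditional
  -- losses given `Z`, and the latter is at least minus the regret.
  have hnull := ((cesaroNull_loss_sub_condExp hT h𝒴 hK hℓ hdom hrm hv).sub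
    (cesaroNull_loss_sub_condExp hT h𝒴 hK hℓ hdom hrm hu.1)).sub
    (CesaroNull.sum Finset.univ fun a _ ↦ CesaroNull.sum Finset.univ fun b _ ↦
      cesaroNull_regret hT h𝒴 (ℓ a) (ℓ b))
  have hlim := ae_zero_le_liminf_of_cesaroNull_le
    (X := fun k ω ↦ lossAt T ℓ k (v k) ω - lossAt T ℓ k (u k) ω) hnull fun k hk ↦ ?_
  · simpa only [avgLoss, Finset.sum_sub_distrib, mul_sub] using hlim
  filter_upwards [hu.condExp_le hT h𝒴 hℓ hdom hrm hr hk (hv k hk)] with ω hω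
  rw [lossAt_eq_representative hℓ hr, lossAt_eq_representative hℓ hr]
  have hreg : (μ[ℓ (r (u k ω)) | obs T 𝒴 (Set.Iic 0)]) (T^[k] ω) -
      (μ[ℓ (r (v k ω)) | obs T 𝒴 (Set.Iic 0)]) (T^[k] ω) ≤
      regret μ T 𝒴 (ℓ (r (v k ω))) (ℓ (r (u k ω))) k (T^[k] ω) := by
    refine (le_max_left _ 0).trans (le_of_eq ?_)
    have hmem : T^[k] ω ∈ {ω' | (μ[ℓ (r (u k ω)) | obs T 𝒴 (Set.Icc (-(k : ℤ)) 0)]) ω' ≤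
        (μ[ℓ (r (v k ω)) | obs T 𝒴 (Set.Icc (-(k : ℤ)) 0)]) ω' + (k : ℝ)⁻¹} := hω
    exact (Set.indicator_of_mem hmem fun ω' ↦
      max ((μ[ℓ (r (u k ω)) | obs T 𝒴 (Set.Iic 0)]) ω' -
        (μ[ℓ (r (v k ω)) | obs T 𝒴 (Set.Iic 0)]) ω') 0).symm
  -- The actions compared depend on `ω` and `k`; summing over all pairs of actions gives one null
  -- sequence that bounds every case.
  have hsum : regret μ T 𝒴 (ℓ (r (v k ω))) (ℓ (r (u k ω))) k (T^[k] ω) ≤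
      ∑ a, ∑ b, regret μ T 𝒴 (ℓ a) (ℓ b) k (T^[k] ω) :=
    (Finset.single_le_sum (f := fun b ↦ regret μ T 𝒴 (ℓ (r (v k ω))) (ℓ b) k (T^[k] ω))
      (fun b _ ↦ regret_nonneg _ _ _ _) (Finset.mem_univ (r (u k ω)))).trans
    (Finset.single_le_sum (f := fun a ↦ ∑ b, regret μ T 𝒴 (ℓ a) (ℓ b) k (T^[k] ω))
      (fun a _ ↦ Finset.sum_nonneg fun b _ ↦ regret_nonneg _ _ _ _)
      (Finset.mem_univ (r (v k ω))))
  linarith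

end MainResult

end PathwiseOptimality

end

theorem mainTheorem5 {Ω : Type*} (𝒴 : MeasurableSpace Ω) [ℬ : MeasurableSpace Ω]
    (μ : MeasureTheory.Measure Ω) [MeasureTheory.IsProbabilityMeasure μ]
    (T : Equiv.Perm Ω) (hT : Ergodic T μ) (hT' : Measurable T.symm) (h𝒴 : 𝒴 ≤ ℬ)
    (hK : PathwiseOptimality.IsCondKAutomorphism
      (PathwiseOptimality.obs T 𝒴 (Set.Iic 0)) μ T)
    {U : Type*} [MeasurableSpace U] [Finite U] [Nonempty U]
    (ℓ : U → Ω → ℝ) (hℓ : Measurable (Function.uncurry ℓ))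
    (hdom : PathwiseOptimality.IsDominated μ ℓ) :
    (∃ u : ℕ → Ω → U, PathwiseOptimality.IsMeanOptimal 𝒴 μ T ℓ u) ∧
      ∀ u : ℕ → Ω → U, PathwiseOptimality.IsMeanOptimal 𝒴 μ T ℓ u →
        PathwiseOptimality.IsPathwiseOptimal 𝒴 μ T ℓ u :=
  have hTk := PathwiseOptimality.measurePreserving_zpow hT.toMeasurePreserving hT'
  ⟨PathwiseOptimality.exists_isMeanOptimal hTk h𝒴 hℓ hdom,
    fun _ hu ↦ hu.isPathwiseOptimal hTk h𝒴 hK hℓ hdom⟩
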